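/- Let $\Sigma$ be a finite alphabet with two distinct symbols $0,1\in\Sigma$. A partial function $g:\subseteq\Sigma^\omega\to\Sigma^\omega$ is computable if it is computed by a Type-2 Turing machine (a Turing machine with a read-only infinite input tape, finitely many work tapes and a one-way output tape, which has to write infinitely many symbols on every input from $\mathrm{dom}(g)$). For $a_1,\dots,a_k\in\Sigma$ let $\iota(a_1\dots a_k)=110a_10a_20\dots a_k011$; for words let $\langle u_1,\dots,u_n\rangle=\iota(u_1)\dots\iota(u_n)$; for a word $v$ and a finite or infinite sequence $p$ let $v\ll p$ mean that $\iota(v)$ is a subword of $p$, and say that $p$ enumerates the set of words $\{v\mid v\ll p\}$ (tuples of words are coded by $\langle\cdot\rangle$). For $p_i\in\Sigma^\omega$, $\langle p_1,\dots,p_n\rangle=p_1(0)\dots p_n(0)p_1(1)\dots p_n(1)\dots$ and $\langle p_0,p_1,\dots\rangle(\tfrac{(i+j)(i+j+1)}2+j)=p_i(j)$. An effective topological space is a tuple $\mathbf X=(X,\tau,\beta,\nu)$ such that $(X,\tau)$ is a $T_0$-space and $\nu:\subseteq\Sigma^*\to\beta$ is a partial function onto a base $\beta$ of $\tau$. A sequence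 $\langle r,s\rangle$ is a $\Delta$-name of $\mathbf X$ if $r$ enumerates the graph of the characteristic function of $\mathrm{dom}(\nu)$ and $s$ enumerates a set $S\subseteq\mathrm{dom}(\nu)^3$ such that $\nu(u)\cap\nu(v)=\bigcup\{\nu(w)\mid(u,v,w)\in S\}$ for all $u,v\in\mathrm{dom}(\nu)$. For a compact set $K\subseteq X$, a sequence $s$ is a $\tilde\kappa_{\mathbf X}$-name of $K$ if for all words $w$: $w\ll s$ iff every $v\ll w$ satisfies $v\in\mathrm{dom}(\nu)$ and $\nu(v)\cap K\neq\emptyset$, and $K\subseteq\bigcup\{\nu(v)\mid v\ll w\}$. A sequence $\langle r,s\rangle$ is a $\tilde\kappa^\Delta$-name of the pair $(\mathbf X,K)$ if $r$ is a $\Delta$-name of $\mathbf X$ and $s$ is a $\tilde\kappa_{\mathbf X}$-name of $K$. The product $\mathbf X_1\times\mathbf X_2$ is the product space with $\nu\langle u_1,u_2\rangle=\nu_1(u_1)\times\nu_2(u_2)$ for $u_i\in\mathrm{dom}(\nu_i)$; finite products are defined by $\mathbf X_1\times\dots\times\mathbf X_{n+1}=(\mathbf X_1\times\dots\times\mathbf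 X_n)\times\mathbf X_{n+1}$; the countable product $\mathbf X_1\times\mathbf X_2\times\dots$ is the product space with $\nu\langle u_1,\dots,u_k\rangle=\nu_1(u_1)\times\dots\times\nu_k(u_k)\times X_{k+1}\times X_{k+2}\times\dots$ for $k\ge1$ and $u_i\in\mathrm{dom}(\nu_i)$. Then the following hold, uniformly in all effective topological spaces $\mathbf X_i$ and all compact sets $K_i\subseteq X_i$. 1. There is a computable function that maps $\langle q_1,q_2\rangle$ to a $\tilde\kappa^\Delta$-name of $(\mathbf X_1\times\mathbf X_2,K_1\times K_2)$ whenever each $q_i$ is a $\tilde\kappa^\Delta$-name of $(\mathbf X_i,K_i)$. 2. There is a computable function that, for all $n\ge1$, maps $1^n0\langle q_1,\dots,q_n\rangle$ to a $\tilde\kappa^\Delta$-name of $(\mathbf X_1\times\dots\times\mathbf X_n,K_1\times\dots\times K_n)$ whenever each $q_i$ is a $\tilde\kappa^\Delta$-name of $(\mathbf X_i,K_i)$. 3. There is a computable function that maps $\langle q_1,q_2,\dots\rangle$ to a $\tilde\kappa^\Delta$-name of $(\mathbf X_1\times\mathbf X_2\times\dots,K_1\times K_2\times\dots)$ whenever each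 $q_i$ is a $\tilde\kappa^\Delta$-name of $(\mathbf X_i,K_i)$ and all the sets $K_i$ are non-empty. -/

import Mathlib

universe u v

namespace TTE

open Set TopologicalSpace

/-! ## Words, sequences and tupling

`A` is a finite alphabet with two distinct symbols `0` and `1`; words are `List A` and infinite
sequences are `ℕ → A`. -/

section Words

variable {A : Type} [Zero A] [One A]

/-- The wrapping function `ι(a₁ a₂ … aₖ) = 1 1 0 a₁ 0 a₂ 0 … aₖ 0 1 1`. -/
def iota (w : List A) : List A :=
  [1, 1, 0] ++ w.flatMap (fun a => [a, 0]) ++ [1, 1]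

/-- The tuple of words `⟨u₁, …, uₙ⟩ = ι(u₁) … ι(uₙ)`. -/
def wordTuple (us : List (List A)) : List A :=
  us.flatMap iota

/-- `v ≪ w` for a finite word `w`: `ι(v)` is a subword of `w`. -/
def OccursW (v w : List A) : Prop :=
  iota v <:+: w

/-- `v ≪ p` for an infinite sequence `p`: `ι(v)` is a subword of `p`. -/
def Occurs (v : List A) (p : ℕ → A) : Prop :=
  ∃ k : ℕ, ∀ (i : ℕ) (h : i < (iota v).length), (iota v)[i] = p (k + i)

/-- For a partial function `μ` from words to `Y`, the notation `μ^fs` of finite subsets: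
`μ^fs(w) = W` iff all `v ≪ w` are in `dom μ` and `W = {μ(v) | v ≪ w}`. -/
def fs {Y : Type*} (μ : List A →. Y) : List A →. Set Y := fun w =>
  ⟨∀ v, OccursW v w → (μ v).Dom, fun _ => {y | ∃ v, OccursW v w ∧ y ∈ μ v}⟩

end Words

/-- The `i`-th component `pᵢ` of a sequence `⟨p₀, …, pₙ₋₁⟩ = p₀(0) … pₙ₋₁(0) p₀(1) … pₙ₋₁(1) …`. -/
def comp {A : Type} (n i : ℕ) (q : ℕ → A) : ℕ → A := fun j => q (n * j + i)

/-- The Cantor pairing function. -/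
def cantorPair (i j : ℕ) : ℕ := (i + j) * (i + j + 1) / 2 + j

/-- The `i`-th component `pᵢ` of the sequence `⟨p₀, p₁, …⟩` that is given by
`⟨p₀, p₁, …⟩ ⟨i, j⟩ = pᵢ(j)`. -/
def compInf {A : Type} (i : ℕ) (q : ℕ → A) : ℕ → A := fun j => q (cantorPair i j)

/-! ## Type-2 Turing machines -/

/-- What a machine does in one step: the next state, the move of the head on the input tape
(`none`: no move), for every work tape the symbol written and the move of its head, and possibly
a symbol that is written on the one-way output tape. -/
structure Action (A State Idx Γ : Type) where
  next : State
  inputMove : Option Turing.Dir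
  write : Idx → Γ
  move : Idx → Option Turing.Dir
  out : Option A

/-- A Type-2 Turing machine from infinite sequences to infinite sequences over `A`: a finite
control, a read-only input tape, finitely many two-way infinite work tapes with a finite work
alphabet (its default element is the blank), and a one-way output tape. -/
structure Machine (A : Type) where
  State : Type
  [finState : Finite State]
  Idx : Type
  [finIdx : Finite Idx]
  Γ : Type
  [finΓ : Finite Γ]
  [blank : Inhabited Γ]
  start : State
  /-- The action, given the state, the scanned input symbol and the scanned work symbols. -/
  δ : State → A → (Idx → Γ) → Action A State Idx Γ

attribute [instance] Machine.finState Machine.finIdx Machine.finΓ Machine.blank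

namespace Machine

variable {A : Type} (M : Machine A)

structure Cfg where
  state : M.State
  inputPos : ℕ
  tapes : M.Idx → Turing.Tape M.Γ
  output : List A

/-- The initial configuration: blank work tapes, nothing written on the output tape. -/
def init : M.Cfg := ⟨M.start, 0, fun _ => default, []⟩

/-- The move of the input head; it stays on the first cell if told to move left from there. -/
def movePos : Option Turing.Dir → ℕ → ℕ
  | none, n => n
  | some Turing.Dir.left, n => n - 1
  | some Turing.Dir.right, n => n + 1

def moveTape {Γ : Type} [Inhabited Γ] : Option Turing.Dir → Turing.Tape Γ → Turing.Tape Γ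
  | none, T => T
  | some d, T => T.move d

/-- One step on the input sequence `p`. -/
def step (p : ℕ → A) (c : M.Cfg) : M.Cfg :=
  let a := M.δ c.state (p c.inputPos) (fun i => (c.tapes i).head)
  { state := a.next
    inputPos := movePos a.inputMove c.inputPos
    tapes := fun i => moveTape (a.move i) ((c.tapes i).write (a.write i))
    output := c.output ++ a.out.toList }

/-- The configuration after `t` steps on the input `p`. -/
def run (p : ℕ → A) (t : ℕ) : M.Cfg := (M.step p)^[t] M.init

/-- On input `p`, the machine writes (working forever) the infinite sequence `q`. -/
def Computes (p q : ℕ → A) : Prop :=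
  ∀ n : ℕ, ∃ t : ℕ, (M.run p t).output[n]? = some (q n)

end Machine

/-- A partial function on infinite sequences is computable if it is the function `f_M` of some
Type-2 Turing machine `M`. -/
def IsComputable {A : Type} (g : (ℕ → A) →. (ℕ → A)) : Prop :=
  ∃ M : Machine A, ∀ p q, q ∈ g p ↔ M.Computes p q

/-! ## Multi-representations -/

/-- A naming relation by infinite sequences: `γ p` is the set of the objects with name `p`. -/
abbrev MultiRep (A : Type) (M : Type v) := (ℕ → A) → Set M

/-- `g` realizes the partial function `f` with respect to `γ`, `γ'`. -/
def Realizes {A : Type} {M : Type u} {M' : Type v} (g : (ℕ → A) →. (ℕ → A))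
    (γ : MultiRep A M) (γ' : MultiRep A M') (f : M →. M') : Prop :=
  ∀ (p : ℕ → A) (x : M), x ∈ γ p → ∀ y ∈ f x, ∃ q ∈ g p, y ∈ γ' q

/-- The partial function `f` is `(γ, γ')`-computable. -/
def ComputableWrt {A : Type} {M : Type u} {M' : Type v}
    (γ : MultiRep A M) (γ' : MultiRep A M') (f : M →. M') : Prop :=
  ∃ g : (ℕ → A) →. (ℕ → A), IsComputable g ∧ Realizes g γ γ' f

namespace MultiRep

variable {A : Type} {M : Type u} {M' : Type v}

/-- `[γ, γ']⟨p₁, p₂⟩ = γ(p₁) × γ'(p₂)`. -/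
def pair (γ : MultiRep A M) (γ' : MultiRep A M') : MultiRep A (M × M') := fun q =>
  {x | x.1 ∈ γ (comp 2 0 q) ∧ x.2 ∈ γ' (comp 2 1 q)}

/-- `[γ]⁺(1ⁿ 0 ⟨p₁, …, pₙ⟩) = {n} × γ(p₁) × … × γ(pₙ)` for `n ≥ 1`, a multi-representation of the
disjoint union of the finite powers `Mⁿ`, `n ≥ 1`; the element `⟨m, x⟩` of the sigma type is an
`n`-tuple for `n = m + 1`. -/
def plus [Zero A] [One A] (γ : MultiRep A M) : MultiRep A (Σ m : ℕ, Fin (m + 1) → M) := fun q =>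
  {x | (∀ i < x.1 + 1, q i = 1) ∧ q (x.1 + 1) = 0 ∧
    ∀ i : Fin (x.1 + 1), x.2 i ∈ γ (comp (x.1 + 1) i fun j => q (x.1 + 2 + j))}

/-- `(x₀, x₁, …) ∈ [γ]^ℕ ⟨p₀, p₁, …⟩` iff `xᵢ ∈ γ(pᵢ)` for all `i`. -/
def seq (γ : MultiRep A M) : MultiRep A (ℕ → M) := fun q =>
  {x | ∀ i, x i ∈ γ (compInf i q)}

end MultiRep

/-! ## Effective topological spaces -/

/-- An effective topological space `(X, τ, β, ν)`: a `T₀`-space with a partial function `ν` from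
words onto a base `β` of its topology (so `β` is the range of `ν`). -/
structure EffSpace (A : Type) : Type (u + 1) where
  carrier : Type u
  [top : TopologicalSpace carrier]
  [t0 : T0Space carrier]
  ν : List A →. Set carrier
  isBase : IsTopologicalBasis ν.ran

attribute [instance] EffSpace.top EffSpace.t0

section Spaces

variable {A : Type} [Zero A] [One A]

/-- The multi-representation `Δ` of the class of effective topological spaces:
`X ∈ Δ⟨r, s⟩` iff `r` enumerates the graph of the characteristic function of `dom ν` and `s`
enumerates a set `S ⊆ (dom ν)³` with `ν(u) ∩ ν(v) = ⋃ {ν(w) | (u, v, w) ∈ S}` for all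
`u, v ∈ dom ν`. -/
def Delta : MultiRep A (EffSpace.{u} A) := fun t =>
  {X | (∀ z, Occurs z (comp 2 0 t) ↔
          ∃ w, (w ∈ X.ν.Dom ∧ z = wordTuple [w, [1]]) ∨ (w ∉ X.ν.Dom ∧ z = wordTuple [w, [0]])) ∧
    ∃ S : Set (List A × List A × List A),
      (∀ u v w, (u, v, w) ∈ S → u ∈ X.ν.Dom ∧ v ∈ X.ν.Dom ∧ w ∈ X.ν.Dom) ∧
      (∀ z, Occurs z (comp 2 1 t) ↔ ∃ u v w, (u, v, w) ∈ S ∧ z = wordTuple [u, v, w]) ∧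
      ∀ u v, ∀ U ∈ X.ν u, ∀ V ∈ X.ν v, U ∩ V = ⋃₀ {W | ∃ w, (u, v, w) ∈ S ∧ W ∈ X.ν w}}

/-- The minimal-cover relation of a space `X`: `p` lists exactly the (names `w` of) finite sets of
base elements that cover `K` and all of whose elements meet `K`. -/
def kappaTilde (X : EffSpace.{u} A) : MultiRep A (Set X.carrier) := fun p =>
  {K | ∀ w, Occurs w p ↔
    (∃ W ∈ fs X.ν w, K ⊆ ⋃₀ W) ∧ ∀ v, OccursW v w → ∃ U ∈ X.ν v, (U ∩ K).Nonempty}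

end Spaces

/-- The class of pairs `(X, K)` of an effective topological space and a compact subset. -/
structure CompactPair (A : Type) : Type (u + 1) where
  space : EffSpace.{u} A
  set : Set space.carrier
  isCompact : IsCompact set

/-- `(X, K) ∈ κ̃^Δ⟨r, s⟩` iff `X ∈ Δ(r)` and `K ∈ κ̃_X(s)`. -/
def kappaTildeDelta {A : Type} [Zero A] [One A] : MultiRep A (CompactPair.{u} A) := fun q =>
  {C | C.space ∈ Delta (comp 2 0 q) ∧ C.set ∈ kappaTilde C.space (comp 2 1 q)}

/-! ## Products -/

section Products

variable {A : Type} [Zero A] [One A] [NeZero (1 : A)]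

theorem iota_append_inj {u v s t : List A} (h : iota u ++ s = iota v ++ t) : u = v ∧ s = t := by
  have h1 : (1 : A) ≠ 0 := NeZero.ne 1
  simp only [iota, List.append_assoc, List.append_cancel_left_eq] at h
  induction u generalizing v with
  | nil =>
    cases v with
    | nil => simpa using h
    | cons b v => simp [h1] at h
  | cons a u ih =>
    cases v with
    | nil => simp [h1.symm] at h
    | cons b v =>
      simp only [List.flatMap_cons, List.cons_append, List.nil_append, List.cons.injEq,
        true_and] at h
      obtain ⟨rfl, h⟩ := h
      obtain ⟨rfl, rfl⟩ := ih h
      exact ⟨rfl, rfl⟩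

theorem wordTuple_injective : Function.Injective (wordTuple (A := A)) := by
  intro us
  induction us with
  | nil =>
    intro vs h
    cases vs with
    | nil => rfl
    | cons v vs => simp [wordTuple, iota] at h
  | cons u us ih =>
    intro vs h
    cases vs with
    | nil => simp [wordTuple, iota] at h
    | cons v vs =>
      simp only [wordTuple, List.flatMap_cons] at h
      obtain ⟨rfl, h'⟩ := iota_append_inj h
      rw [ih h']

/-- The notation of the base of `X₁ × X₂`: `ν⟨u₁, u₂⟩ = ν₁(u₁) × ν₂(u₂)` for `uᵢ ∈ dom νᵢ`. -/
def prodNu (X Y : EffSpace.{u} A) : List A →. Set (X.carrier × Y.carrier) := fun w =>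
  ⟨∃ u₁ u₂, w = wordTuple [u₁, u₂] ∧ u₁ ∈ X.ν.Dom ∧ u₂ ∈ Y.ν.Dom,
    fun _ => {x | ∃ u₁ u₂, w = wordTuple [u₁, u₂] ∧
      (∃ U ∈ X.ν u₁, x.1 ∈ U) ∧ ∃ V ∈ Y.ν u₂, x.2 ∈ V}⟩

theorem mem_prodNu {X Y : EffSpace.{u} A} {w : List A} {S : Set (X.carrier × Y.carrier)} :
    S ∈ prodNu X Y w ↔
      ∃ u₁ u₂, w = wordTuple [u₁, u₂] ∧ ∃ U ∈ X.ν u₁, ∃ V ∈ Y.ν u₂, S = U ×ˢ V := by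
  have key : ∀ u₁ u₂ U V, U ∈ X.ν u₁ → V ∈ Y.ν u₂ →
      {x : X.carrier × Y.carrier | ∃ v₁ v₂, wordTuple [u₁, u₂] = wordTuple [v₁, v₂] ∧
        (∃ U ∈ X.ν v₁, x.1 ∈ U) ∧ ∃ V ∈ Y.ν v₂, x.2 ∈ V} = U ×ˢ V := by
    intro u₁ u₂ U V hU hV
    ext x
    constructor
    · rintro ⟨v₁, v₂, h, ⟨U', hU', hx⟩, V', hV', hy⟩
      have h' := wordTuple_injective h
      simp only [List.cons.injEq, and_true] at h'
      obtain ⟨rfl, rfl⟩ := h'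
      rw [Part.mem_unique hU hU', Part.mem_unique hV hV']
      exact ⟨hx, hy⟩
    · rintro ⟨hx, hy⟩
      exact ⟨u₁, u₂, rfl, ⟨U, hU, hx⟩, V, hV, hy⟩
  constructor
  · rintro ⟨⟨u₁, u₂, rfl, h1, h2⟩, rfl⟩
    exact ⟨u₁, u₂, rfl, _, Part.get_mem h1, _, Part.get_mem h2,
      key _ _ _ _ (Part.get_mem h1) (Part.get_mem h2)⟩
  · rintro ⟨u₁, u₂, rfl, U, hU, V, hV, rfl⟩
    exact ⟨⟨u₁, u₂, rfl, Part.dom_iff_mem.2 ⟨_, hU⟩, Part.dom_iff_mem.2 ⟨_, hV⟩⟩,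
      key _ _ _ _ hU hV⟩

/-- The product `X₁ × X₂`. The topology generated by the base is the product topology. -/
def EffSpace.prod (X Y : EffSpace.{u} A) : EffSpace.{u} A where
  carrier := X.carrier × Y.carrier
  ν := prodNu X Y
  isBase := by
    have h : (prodNu X Y).ran = Set.image2 (· ×ˢ ·) X.ν.ran Y.ν.ran := by
      ext S
      constructor
      · rintro ⟨w, hw⟩
        obtain ⟨u₁, u₂, -, U, hU, V, hV, rfl⟩ := mem_prodNu.1 hw
        exact ⟨U, ⟨u₁, hU⟩, V, ⟨u₂, hV⟩, rfl⟩
      · rintro ⟨U, ⟨u₁, hU⟩, V, ⟨u₂, hV⟩, rfl⟩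
        exact ⟨_, mem_prodNu.2 ⟨u₁, u₂, rfl, U, hU, V, hV, rfl⟩⟩
    rw [h]
    exact X.isBase.prod Y.isBase

/-- The notation of the base of `X₀ × X₁ × …`:
`ν⟨u₀, …, uₖ₋₁⟩ = ν₀(u₀) × … × νₖ₋₁(uₖ₋₁) × Xₖ × Xₖ₊₁ × …` for `k ≥ 1` and `uᵢ ∈ dom νᵢ`. -/
def piNu (X : ℕ → EffSpace.{u} A) : List A →. Set (∀ i, (X i).carrier) := fun w =>
  ⟨∃ us : List (List A), us ≠ [] ∧ w = wordTuple us ∧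
      ∀ (i : ℕ) (h : i < us.length), us[i] ∈ (X i).ν.Dom,
    fun _ => {x | ∃ us : List (List A), us ≠ [] ∧ w = wordTuple us ∧
      ∀ (i : ℕ) (h : i < us.length), ∃ U ∈ (X i).ν us[i], x i ∈ U}⟩

theorem mem_piNu {X : ℕ → EffSpace.{u} A} {w : List A} {S : Set (∀ i, (X i).carrier)} :
    S ∈ piNu X w ↔
      ∃ us : List (List A), us ≠ [] ∧ w = wordTuple us ∧
        ∃ U : ∀ i, Set (X i).carrier, (∀ (i : ℕ) (h : i < us.length), U i ∈ (X i).ν us[i]) ∧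
          S = {x | ∀ i < us.length, x i ∈ U i} := by
  have key : ∀ (us : List (List A)) (U : ∀ i, Set (X i).carrier), us ≠ [] →
      (∀ (i : ℕ) (h : i < us.length), U i ∈ (X i).ν us[i]) →
      {x : ∀ i, (X i).carrier | ∃ vs : List (List A), vs ≠ [] ∧ wordTuple us = wordTuple vs ∧
        ∀ (i : ℕ) (h : i < vs.length), ∃ U ∈ (X i).ν vs[i], x i ∈ U} =
      {x | ∀ i < us.length, x i ∈ U i} := by
    intro us U hne hU
    ext x
    constructor
    · rintro ⟨vs, -, h, hx⟩ i hi
      obtain rfl := wordTuple_injective h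
      obtain ⟨U', hU', hxU⟩ := hx i hi
      rwa [Part.mem_unique (hU i hi) hU']
    · intro hx
      exact ⟨us, hne, rfl, fun i hi => ⟨U i, hU i hi, hx i hi⟩⟩
  constructor
  · rintro ⟨⟨us, hne, rfl, hd⟩, rfl⟩
    have hU : ∀ (i : ℕ) (h : i < us.length),
        (if h : i < us.length then ((X i).ν us[i]).get (hd i h) else ∅) ∈ (X i).ν us[i] := by
      intro i h
      rw [dif_pos h]
      exact Part.get_mem _
    exact ⟨us, hne, rfl, _, hU, key us _ hne hU⟩
  · rintro ⟨us, hne, rfl, U, hU, rfl⟩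
    exact ⟨⟨us, hne, rfl, fun i h => Part.dom_iff_mem.2 ⟨_, hU i h⟩⟩, key us U hne hU⟩

/-- The countable product `X₀ × X₁ × …`. The topology generated by the base is the product
topology. -/
def EffSpace.pi (X : ℕ → EffSpace.{u} A) : EffSpace.{u} A where
  carrier := ∀ i, (X i).carrier
  ν := piNu X
  isBase := by
    refine isTopologicalBasis_of_isOpen_of_nhds ?_ ?_
    · rintro S ⟨w, hw⟩
      obtain ⟨us, -, -, U, hU, rfl⟩ := mem_piNu.1 hw
      have : {x : ∀ i, (X i).carrier | ∀ i < us.length, x i ∈ U i} =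
          ⋂ i ∈ Set.Iio us.length, (fun x : ∀ i, (X i).carrier => x i) ⁻¹' U i := by
        ext x
        simp
      rw [this]
      exact (Set.finite_Iio _).isOpen_biInter fun i hi =>
        ((X i).isBase.isOpen ⟨_, hU i hi⟩).preimage (continuous_apply i)
    · intro x O hx hO
      obtain ⟨F, V, hV, hVO⟩ := isOpen_pi_iff.1 hO x hx
      classical
      have hex : ∀ i, ∃ (u : List A) (U : Set (X i).carrier), U ∈ (X i).ν u ∧ x i ∈ U ∧
          (i ∈ F → U ⊆ V i) := by
        intro i
        have hopen : IsOpen (if i ∈ F then V i else Set.univ) := by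
          split_ifs with hi
          · exact (hV i hi).1
          · exact isOpen_univ
        have hmem : x i ∈ (if i ∈ F then V i else Set.univ) := by
          split_ifs with hi
          · exact (hV i hi).2
          · trivial
        obtain ⟨U, ⟨u, hu⟩, hxU, hUV⟩ := (X i).isBase.exists_subset_of_mem_open hmem hopen
        exact ⟨u, U, hu, hxU, fun hi => by simpa [hi] using hUV⟩
      choose u U hU hxU hUV using hex
      let k := F.sup id + 1
      refine ⟨{y | ∀ i < k, y i ∈ U i}, ⟨wordTuple (List.ofFn fun i : Fin k => u i), ?_⟩,
        fun i _ => hxU i, ?_⟩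
      · refine mem_piNu.2 ⟨List.ofFn fun i : Fin k => u i, ?_, rfl, U, ?_, ?_⟩
        · simp [k]
        · intro i h
          rw [List.getElem_ofFn]
          exact hU i
        · rw [List.length_ofFn]
      · intro y hy
        exact hVO fun i hi => hUV i hi (hy i (Nat.lt_succ_of_le (Finset.le_sup (f := id) hi)))

namespace CompactPair

/-- `((X₁, K₁), (X₂, K₂)) ↦ (X₁ × X₂, K₁ × K₂)`. -/
def prod (C : CompactPair.{u} A × CompactPair.{u} A) : CompactPair.{u} A where
  space := C.1.space.prod C.2.space
  set := C.1.set ×ˢ C.2.set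
  isCompact := C.1.isCompact.prod C.2.isCompact

/-- The finite product `((X₁, K₁), …, (Xₙ, Kₙ)) ↦ (X₁ × … × Xₙ, K₁ × … × Kₙ)` for `n = m + 1`,
where `X₁ × … × Xₙ₊₁ := (X₁ × … × Xₙ) × Xₙ₊₁` by induction, and the one-fold product is `X₁`. -/
def finProdAux : (m : ℕ) → (Fin (m + 1) → CompactPair.{u} A) → CompactPair.{u} A
  | 0, C => C 0
  | m + 1, C => prod (finProdAux m fun i => C i.castSucc, C (Fin.last (m + 1)))

/-- The finite products, uniformly in the number of factors. -/
def finProd (C : Σ m : ℕ, Fin (m + 1) → CompactPair.{u} A) : CompactPair.{u} A :=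
  finProdAux C.1 C.2

/-- `((X₀, K₀), (X₁, K₁), …) ↦ (X₀ × X₁ × …, K₀ × K₁ × …)`. -/
def pi (C : ℕ → CompactPair.{u} A) : CompactPair.{u} A where
  space := EffSpace.pi fun i => (C i).space
  set := Set.univ.pi fun i => (C i).set
  isCompact := isCompact_univ_pi fun i => (C i).isCompact

/-- The countable product, as a partial function on the sequences with non-empty `Kᵢ`. -/
def piNonempty : (ℕ → CompactPair.{u} A) →. CompactPair.{u} A := fun C =>
  ⟨∀ i, (C i).set.Nonempty, fun _ => pi C⟩

end CompactPair

end Products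

end TTE

namespace TTE

open Turing Turing.PartrecToTM2

/-! ## Simulating stack programs by Type-2 machines -/

/-- The statements of the stack programs for partial recursive functions. -/
abbrev StackStmt := TM2.Stmt (fun _ : K' => Γ') Λ' (Option Γ')

/-- The tape `T` holds the stack `l`: the head scans the top of the stack, and the stack extends
to the left. What is to the right of the head is irrelevant. -/
def StackTape {B : Type} (T : Tape (Option B)) (l : List B) : Prop :=
  T.left.cons T.head = ListBlank.mk (l.map some)

namespace StackTape

variable {B : Type} {T : Tape (Option B)} {l : List B}

theorem head_eq (h : StackTape T l) : T.head = l.head? := by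
  have := congrArg ListBlank.head h
  rw [ListBlank.head_cons, ListBlank.head_mk] at this
  rw [this]
  cases l <;> rfl

theorem pop (h : StackTape T l) : StackTape ((T.write none).move Dir.left) l.tail := by
  have := congrArg ListBlank.tail h
  rw [ListBlank.tail_cons, ListBlank.tail_mk] at this
  simp only [StackTape, Tape.move, Tape.write, ListBlank.cons_head_tail]
  rw [this, List.map_tail]

theorem push (h : StackTape T l) (b : B) :
    StackTape ((T.move Dir.right).write (some b)) (b :: l) := by
  have h' : T.left.cons T.head = ListBlank.mk (l.map some) := h
  simp only [StackTape, Tape.move, Tape.write, h', List.map_cons, ListBlank.cons_mk]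

theorem nil : StackTape (default : Tape (Option B)) [] := by
  change ListBlank.cons none (ListBlank.mk []) = ListBlank.mk []
  exact ListBlank.cons_head_tail (ListBlank.mk ([] : List (Option B)))

end StackTape

instance : Finite K' :=
  Finite.of_surjective (fun i : Fin 4 => ![K'.main, K'.rev, K'.aux, K'.stack] i) fun k => by
    cases k
    exacts [⟨0, rfl⟩, ⟨1, rfl⟩, ⟨2, rfl⟩, ⟨3, rfl⟩]

/-- The control states of the machine that alternates between reading an input symbol, running a
stack program, and writing at most one output symbol. -/
inductive Ctl
  | start
  | readIn
  | run (q : StackStmt) (v : Option Γ')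
  | write (k : K') (x : Γ') (q : StackStmt) (v : Option Γ')
  | popOut (j : ℕ)

namespace Ctl

section

variable {A : Type} (c : ToPartrec.Code) (e : A → ℕ) (d : ℕ → Option A) (J : ℕ)

/-- The program that pushes `j` in unary and then starts the program of the code `c`. -/
def inStmt (j : ℕ) : StackStmt :=
  Nat.rec (TM2.Stmt.goto fun _ => trNormal c Cont'.halt)
    (fun _ q => TM2.Stmt.push K'.main (fun _ => Γ'.bit1) q) j

/-- Like `inStmt`, after creating the representation of `0` on the main stack. -/
def startStmt (j : ℕ) : StackStmt :=
  TM2.Stmt.push K'.main (fun _ => Γ'.cons) <| TM2.Stmt.push K'.main (fun _ => Γ'.cons) <| inStmt c j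

/-- The transition function. -/
def act : Ctl → A → (K' → Option Γ') → Action A Ctl K' (Option Γ')
  | start, a, h => ⟨run (startStmt c (e a)) none, none, h, fun _ => none, none⟩
  | readIn, a, h => ⟨run (inStmt c (e a)) none, none, h, fun _ => none, none⟩
  | run (TM2.Stmt.push k f q) v, _, h =>
    ⟨write k (f v) q v, none, h, Function.update (fun _ => none) k (some Dir.right), none⟩
  | run (TM2.Stmt.peek k f q) v, _, h => ⟨run q (f v (h k)), none, h, fun _ => none, none⟩
  | run (TM2.Stmt.pop k f q) v, _, h =>
    ⟨run q (f v (h k)), none, Function.update h k none,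
      Function.update (fun _ => none) k (some Dir.left), none⟩
  | run (TM2.Stmt.load f q) v, _, h => ⟨run q (f v), none, h, fun _ => none, none⟩
  | run (TM2.Stmt.branch f q₁ q₂) v, _, h =>
    ⟨run (cond (f v) q₁ q₂) v, none, h, fun _ => none, none⟩
  | run (TM2.Stmt.goto f) v, _, h => ⟨run (tr (f v)) v, none, h, fun _ => none, none⟩
  | run TM2.Stmt.halt _, _, h => ⟨popOut 0, none, h, fun _ => none, none⟩
  | write k x q v, _, h => ⟨run q v, none, Function.update h k (some x), fun _ => none, none⟩
  | popOut j, _, h =>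
    if h K'.main = some Γ'.bit1 then
      ⟨popOut (min (j + 1) J), none, Function.update h K'.main none,
        Function.update (fun _ => none) K'.main (some Dir.left), none⟩
    else ⟨readIn, some Dir.right, h, fun _ => none, d j⟩

/-- The statements that can occur in a run. -/
def Reachable (q : StackStmt) : Prop :=
  some q ∈ TM2.stmts tr (codeSupp c Cont'.halt) ∨ ∃ a, q ∈ TM2.stmts₁ (startStmt c (e a))

/-- The control states that can occur in a run. -/
def Valid : Ctl → Prop
  | start => True
  | readIn => True
  | run q _ => Reachable c e q
  | write _ _ q _ => Reachable c e q
  | popOut j => j ≤ J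

variable {c e J}

theorem Reachable.mono {q q' : StackStmt} (h : Reachable c e q) (hq : q' ∈ TM2.stmts₁ q) :
    Reachable c e q' := by
  rcases h with h | ⟨a, h⟩
  · exact Or.inl (TM2.stmts_trans hq h)
  · exact Or.inr ⟨a, TM2.stmts₁_trans h hq⟩

theorem supportsStmt_inStmt (j : ℕ) :
    TM2.SupportsStmt (codeSupp c Cont'.halt) (inStmt c j) := by
  induction j with
  | zero => exact fun _ => codeSupp_self _ _ (trStmts₁_self _)
  | succ j ih => exact ih

theorem Reachable.supports {q : StackStmt} (h : Reachable c e q) :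
    TM2.SupportsStmt (codeSupp c Cont'.halt) q := by
  rcases h with h | ⟨a, h⟩
  · let _ : Inhabited Λ' := ⟨trNormal c Cont'.halt⟩
    exact TM2.stmts_supportsStmt (tr_supports c Cont'.halt) h
  · exact TM2.stmts₁_supportsStmt_mono h (supportsStmt_inStmt (e a))

theorem Reachable.tr {f : Option Γ' → Λ'}
    (h : Reachable c e (TM2.Stmt.goto f))
    (v : Option Γ') : Reachable c e (tr (f v)) := by
  classical
  refine Or.inl (Finset.some_mem_insertNone.2 (Finset.mem_biUnion.2 ?_))
  exact ⟨f v, h.supports v, TM2.stmts₁_self⟩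

theorem reachable_startStmt (a : A) : Reachable c e (startStmt c (e a)) :=
  Or.inr ⟨a, TM2.stmts₁_self⟩

theorem reachable_inStmt (a : A) : Reachable c e (inStmt c (e a)) := by
  refine (reachable_startStmt a).mono ?_
  simp only [startStmt, TM2.stmts₁, Finset.mem_insert]
  exact Or.inr (Or.inr TM2.stmts₁_self)

theorem valid_act {s : Ctl} (hs : Valid c e J s) (a : A) (h : K' → Option Γ') :
    Valid c e J (act c e d J s a h).next := by
  have sub : ∀ {q : StackStmt}, Reachable c e q → ∀ q', q' ∈ TM2.stmts₁ q → Reachable c e q' :=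
    fun h _ hq => h.mono hq
  cases s with
  | start => exact reachable_startStmt a
  | readIn => exact reachable_inStmt a
  | write k x q v => exact hs
  | popOut j =>
    simp only [act]
    split_ifs
    · exact min_le_right _ _
    · trivial
  | run q v =>
    cases q with
    | goto f => exact Reachable.tr hs v
    | halt => exact Nat.zero_le _
    | branch f q₁ q₂ =>
      refine sub hs _ ?_
      simp only [TM2.stmts₁, Finset.mem_insert, Finset.mem_union]
      cases f v
      · exact Or.inr (Or.inr TM2.stmts₁_self)
      · exact Or.inr (Or.inl TM2.stmts₁_self)
    | load f q => exact sub hs _ (by simp [TM2.stmts₁, TM2.stmts₁_self])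
    | push k f q => exact sub hs _ (by simp [TM2.stmts₁, TM2.stmts₁_self])
    | peek k f q => exact sub hs _ (by simp [TM2.stmts₁, TM2.stmts₁_self])
    | pop k f q => exact sub hs _ (by simp [TM2.stmts₁, TM2.stmts₁_self])

theorem finite_reachable [Finite A] : {q | Reachable c e q}.Finite := by
  refine Set.Finite.union ?_ ?_
  · exact (Finset.finite_toSet (TM2.stmts tr (codeSupp c Cont'.halt))).preimage
      (Option.some_injective _).injOn
  · have : {q | ∃ a, q ∈ TM2.stmts₁ (startStmt c (e a))} =
        ⋃ a, ((TM2.stmts₁ (startStmt c (e a)) : Finset _) : Set _) := by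
      ext q
      simp
    exact (Set.finite_iUnion fun a => Finset.finite_toSet _).subset this.le

theorem finite_valid [Finite A] : Finite {s // Valid c e J s} := by
  have hf := (finite_reachable (c := c) (e := e))
  have h1 : ((fun x : StackStmt × Option Γ' => run x.1 x.2) ''
      ({q | Reachable c e q} ×ˢ Set.univ)).Finite := (hf.prod Set.finite_univ).image _
  have h2 : ((fun x : K' × Γ' × StackStmt × Option Γ' => write x.1 x.2.1 x.2.2.1 x.2.2.2) ''
      (Set.univ ×ˢ Set.univ ×ˢ {q | Reachable c e q} ×ˢ Set.univ)).Finite :=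
    (Set.finite_univ.prod (Set.finite_univ.prod (hf.prod Set.finite_univ))).image _
  have h3 : (popOut '' Set.Iic J).Finite := (Set.finite_Iic J).image _
  refine Set.Finite.subset (((Set.toFinite {start, readIn}).union h1).union (h2.union h3)) ?_
  intro s hs
  cases s with
  | start => simp
  | readIn => simp
  | run q v => exact Or.inl (Or.inr ⟨(q, v), ⟨hs, trivial⟩, rfl⟩)
  | write k x q v => exact Or.inr (Or.inl ⟨(k, x, q, v), ⟨trivial, trivial, hs, trivial⟩, rfl⟩)
  | popOut j => exact Or.inr (Or.inr ⟨j, hs, rfl⟩)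

end

/-- The machine with the transition function `Ctl.act`. -/
def machine {A : Type} [Finite A] (c : ToPartrec.Code) (e : A → ℕ) (d : ℕ → Option A) (J : ℕ) :
    Machine A :=
  haveI := finite_valid (c := c) (e := e) (J := J)
  { State := {s // Valid c e J s}
    Idx := K'
    Γ := Option Γ'
    start := ⟨start, trivial⟩
    δ := fun s a h =>
      { next := ⟨(act c e d J s.1 a h).next, valid_act d s.2 a h⟩
        inputMove := (act c e d J s.1 a h).inputMove
        write := (act c e d J s.1 a h).write
        move := (act c e d J s.1 a h).move
        out := (act c e d J s.1 a h).out } }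

variable {A : Type} {c : ToPartrec.Code} {e : A → ℕ} {d : ℕ → Option A} {J : ℕ}

/-- A configuration of the machine `Ctl.machine`. -/
structure Cfg (A : Type) where
  state : Ctl
  inputPos : ℕ
  tapes : K' → Tape (Option Γ')
  output : List A

/-- One step on the input sequence `p`. -/
def step (c : ToPartrec.Code) (e : A → ℕ) (d : ℕ → Option A) (J : ℕ) (p : ℕ → A) (C : Cfg A) :
    Cfg A :=
  let a := act c e d J C.state (p C.inputPos) (fun i => (C.tapes i).head)
  { state := a.next
    inputPos := Machine.movePos a.inputMove C.inputPos
    tapes := fun i => Machine.moveTape (a.move i) ((C.tapes i).write (a.write i))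
    output := C.output ++ a.out.toList }

/-- The configuration of a machine as a `Ctl.Cfg`. -/
def ofCfg [Finite A] (C : (machine c e d J).Cfg) : Cfg A :=
  ⟨C.state.1, C.inputPos, C.tapes, C.output⟩

theorem ofCfg_iterate [Finite A] (p : ℕ → A) (t : ℕ) (C : (machine c e d J).Cfg) :
    ofCfg (((machine c e d J).step p)^[t] C) = (step c e d J p)^[t] (ofCfg C) := by
  induction t generalizing C with
  | zero => rfl
  | succ t ih => exact ih _

/-- The configuration `C` has control state `s`, input position `n`, stacks `S`, output `o`. -/
def Repr (C : Cfg A) (s : Ctl) (n : ℕ) (S : K' → List Γ') (o : List A) : Prop :=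
  C.state = s ∧ C.inputPos = n ∧ (∀ k, StackTape (C.tapes k) (S k)) ∧ C.output = o

theorem Repr.heads {C : Cfg A} {s n S o} (h : Repr C s n S o) :
    (fun k => (C.tapes k).head) = fun k => (S k).head? :=
  funext fun k => (h.2.2.1 k).head_eq

/-- Reachability between represented configurations. -/
def Leads (c : ToPartrec.Code) (e : A → ℕ) (d : ℕ → Option A) (J : ℕ) (p : ℕ → A)
    (x y : Ctl × ℕ × (K' → List Γ') × List A) : Prop :=
  ∀ C : Cfg A, Repr C x.1 x.2.1 x.2.2.1 x.2.2.2 →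
    ∃ t, Repr ((step c e d J p)^[t] C) y.1 y.2.1 y.2.2.1 y.2.2.2

theorem Leads.refl (p : ℕ → A) (x) : Leads c e d J p x x := fun _ h => ⟨0, h⟩

theorem Leads.trans {p : ℕ → A} {x y z} (h : Leads c e d J p x y) (h' : Leads c e d J p y z) :
    Leads c e d J p x z := by
  intro C hC
  obtain ⟨t, ht⟩ := h C hC
  obtain ⟨t', ht'⟩ := h' _ ht
  exact ⟨t' + t, by rwa [Function.iterate_add_apply]⟩

/-- One step that leaves the tapes unchanged. -/
theorem leads_of_silent {p : ℕ → A} {s s' : Ctl} {n : ℕ} {S : K' → List Γ'} {o : List A}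
    {i : Option Dir} {x : Option A}
    (h : act c e d J s (p n) (fun k => (S k).head?) =
      ⟨s', i, fun k => (S k).head?, fun _ => none, x⟩) :
    Leads c e d J p (s, n, S, o) (s', Machine.movePos i n, S, o ++ x.toList) := by
  intro C hC
  have hh := hC.heads
  obtain ⟨rfl, rfl, hT, rfl⟩ := hC
  simp only at hh h hT
  refine ⟨1, ?_⟩
  simp only [Function.iterate_one, Repr, step, hh, h, Machine.moveTape, true_and, and_true]
  intro k
  rw [← (hT k).head_eq, Tape.write_self]
  exact hT k

/-- One step that pops from the stack `k`. -/
theorem leads_of_pop {p : ℕ → A} {s s' : Ctl} {n : ℕ} {S : K' → List Γ'} {o : List A} {k : K'}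
    (h : act c e d J s (p n) (fun k => (S k).head?) =
      ⟨s', none, Function.update (fun k => (S k).head?) k none,
        Function.update (fun _ => none) k (some Dir.left), none⟩) :
    Leads c e d J p (s, n, S, o) (s', n, Function.update S k (S k).tail, o) := by
  intro C hC
  have hh := hC.heads
  obtain ⟨rfl, rfl, hT, rfl⟩ := hC
  simp only at hh h hT
  refine ⟨1, ?_⟩
  simp only [Function.iterate_one, Repr, step, hh, h, Machine.movePos, true_and, and_true,
    Option.toList_none, List.append_nil]
  intro k'
  by_cases hk : k' = k
  · subst hk
    simp only [Function.update_self, Machine.moveTape]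
    exact (hT k').pop
  · simp only [Function.update_of_ne hk, Machine.moveTape]
    rw [← (hT k').head_eq, Tape.write_self]
    exact hT k'

theorem leads_push {p : ℕ → A} {n : ℕ} {S : K' → List Γ'} {o : List A} {k : K'}
    {f : Option Γ' → Γ'} {q : StackStmt} {v : Option Γ'} :
    Leads c e d J p (run (TM2.Stmt.push k f q) v, n, S, o)
      (run q v, n, Function.update S k (f v :: S k), o) := by
  rintro ⟨s, n', T, o'⟩ ⟨h1, h2, hT, h4⟩
  simp only at h1 h2 hT h4
  subst h1 h2 h4
  refine ⟨2, ?_⟩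
  simp only [Function.iterate_succ, Function.iterate_zero, Function.comp_apply, id_eq, Repr, step,
    act, Machine.movePos, true_and, and_true, Option.toList_none, List.append_nil]
  intro k'
  by_cases hk : k' = k
  · subst hk
    simp only [Function.update_self, Machine.moveTape, Tape.write_self]
    exact (hT k').push _
  · simp only [Function.update_of_ne hk, Machine.moveTape, Tape.write_self]
    exact hT k'

theorem leads_silent_none {p : ℕ → A} {s s' : Ctl} {n : ℕ} {S : K' → List Γ'} {o : List A}
    (h : act c e d J s (p n) (fun k => (S k).head?) =
      ⟨s', none, fun k => (S k).head?, fun _ => none, none⟩) :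
    Leads c e d J p (s, n, S, o) (s', n, S, o) := by
  simpa [Machine.movePos] using leads_of_silent (o := o) h

/-- The control state that represents a position in a stack program. -/
def ofLabel (l : Option Λ') (v : Option Γ') : Ctl :=
  l.elim (popOut 0) fun l => run (tr l) v

theorem leads_stepAux (p : ℕ → A) (n : ℕ) (o : List A) (q : StackStmt) (v : Option Γ')
    (S : K' → List Γ') :
    Leads c e d J p (run q v, n, S, o)
      (ofLabel (TM2.stepAux q v S).l (TM2.stepAux q v S).var, n, (TM2.stepAux q v S).stk, o) := by
  induction q generalizing v S with
  | push k f q ih => exact leads_push.trans (ih _ _)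
  | peek k f q ih => exact (leads_silent_none rfl).trans (ih _ _)
  | pop k f q ih => exact (leads_of_pop rfl).trans (ih _ _)
  | load f q ih => exact (leads_silent_none rfl).trans (ih _ _)
  | branch f q₁ q₂ ih₁ ih₂ =>
    refine (leads_silent_none rfl).trans ?_
    simp only [TM2.stepAux]
    cases f v
    · exact ih₂ _ _
    · exact ih₁ _ _
  | goto f => exact leads_silent_none rfl
  | halt => exact leads_silent_none rfl

theorem leads_of_reaches (p : ℕ → A) (n : ℕ) (o : List A)
    {x y : TM2.Cfg (fun _ : K' => Γ') Λ' (Option Γ')}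
    (h : StateTransition.Reaches (TM2.step tr) x y) :
    Leads c e d J p (ofLabel x.l x.var, n, x.stk, o) (ofLabel y.l y.var, n, y.stk, o) := by
  induction h with
  | refl => exact Leads.refl _ _
  | tail _ h ih =>
    refine ih.trans ?_
    rename_i y z _
    obtain ⟨l, v, S⟩ := y
    cases l with
    | none => simp [TM2.step] at h
    | some l =>
      simp only [TM2.step, Option.mem_def, Option.some.injEq] at h
      subst h
      exact leads_stepAux _ _ _ _ _ _

theorem leads_inStmt (p : ℕ → A) (n : ℕ) (o : List A) (j : ℕ) (l : List Γ') :
    Leads c e d J p (run (inStmt c j) none, n, K'.elim l [] [] [], o)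
      (run (tr (trNormal c Cont'.halt)) none, n,
        K'.elim (List.replicate j Γ'.bit1 ++ l) [] [] [], o) := by
  induction j generalizing l with
  | zero => exact leads_silent_none rfl
  | succ j ih =>
    refine leads_push.trans ?_
    rw [K'.elim_update_main, List.replicate_succ', List.append_assoc]
    exact ih _

theorem leads_popOut (p : ℕ → A) (n : ℕ) (o : List A) (i j : ℕ) (l : List Γ') (hJ : i + j ≤ J) :
    Leads c e d J p
      (popOut i, n, K'.elim (List.replicate j Γ'.bit1 ++ Γ'.cons :: l) [] [] [], o)
      (readIn, n + 1, K'.elim (Γ'.cons :: l) [] [] [], o ++ (d (i + j)).toList) := by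
  induction j generalizing i with
  | zero => exact leads_of_silent (i := some Dir.right) rfl
  | succ j ih =>
    refine (leads_of_pop (k := K'.main) (s' := popOut (i + 1)) ?_).trans ?_
    · rw [← min_eq_left (show i + 1 ≤ J by lia)]
      rfl
    · rw [K'.elim_update_main]
      have := ih (i + 1) (by lia)
      rwa [show i + 1 + j = i + (j + 1) by lia] at this

end Ctl

theorem trNat_double_succ (n : ℕ) : trNat (2 * n + 1) = Γ'.bit1 :: trNat n := by
  have h : ((2 * n + 1 : ℕ) : Num) = Num.bit1 (n : Num) := by
    rw [← Num.bit1_of_bit1, two_mul]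
    push_cast
    rfl
  unfold trNat
  rw [h]
  cases (n : Num) <;> rfl

theorem trNat_two_pow_sub_one (j : ℕ) : trNat (2 ^ j - 1) = List.replicate j Γ'.bit1 := by
  induction j with
  | zero => simp
  | succ j ih =>
    have h := Nat.one_le_two_pow (n := j)
    rw [show 2 ^ (j + 1) - 1 = 2 * (2 ^ j - 1) + 1 by rw [pow_succ]; lia, trNat_double_succ, ih,
      List.replicate_succ]

namespace Ctl

variable {A : Type} {c : ToPartrec.Code} {e : A → ℕ} {d : ℕ → Option A} {J : ℕ}

theorem leads_compute {f g : A → ℕ → ℕ}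
    (hc : ∀ a s, [2 ^ g a s - 1, f a s] ∈ c.eval [2 ^ e a - 1, s]) (hg : ∀ a s, g a s ≤ J)
    (p : ℕ → A) (n : ℕ) (o : List A) (a : A) (s : ℕ) :
    Leads c e d J p (run (inStmt c (e a)) none, n, K'.elim (Γ'.cons :: trList [s]) [] [] [], o)
      (readIn, n + 1, K'.elim (Γ'.cons :: trList [f a s]) [] [] [],
        o ++ (d (g a s)).toList) := by
  refine (leads_inStmt _ _ _ _ _).trans ?_
  have h : halt [2 ^ g a s - 1, f a s] ∈ StateTransition.eval (TM2.step tr)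
      (init c [2 ^ e a - 1, s]) := by
    rw [tr_eval]
    exact Part.mem_map _ (hc a s)
  have h' := leads_of_reaches (c := c) (e := e) (d := d) (J := J) p n o
    (StateTransition.mem_eval.1 h).1
  simp only [init, PartrecToTM2.halt, ofLabel, Option.elim, trList, trNat_two_pow_sub_one] at h'
  refine h'.trans ?_
  have := leads_popOut (c := c) (e := e) (d := d) (J := J) p n o 0 (g a s)
    (trNat (f a s) ++ [Γ'.cons]) (by simpa using hg a s)
  simpa using this

theorem exists_output [Finite A] {f g : A → ℕ → ℕ}
    (hc : ∀ a s, [2 ^ g a s - 1, f a s] ∈ c.eval [2 ^ e a - 1, s]) (hg : ∀ a s, g a s ≤ J)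
    (p : ℕ → A) (st : ℕ → ℕ) (h0 : st 0 = 0) (hst : ∀ n, st (n + 1) = f (p n) (st n)) (n : ℕ) :
    ∃ t, ((machine c e d J).run p t).output =
      (List.range n).flatMap fun i => (d (g (p i) (st i))).toList := by
  have key : ∀ n, Leads c e d J p (start, 0, fun _ => [], [])
      (readIn, n + 1, K'.elim (Γ'.cons :: trList [st (n + 1)]) [] [] [],
        (List.range (n + 1)).flatMap fun i => (d (g (p i) (st i))).toList) := by
    intro n
    induction n with
    | zero =>
      refine (leads_silent_none (s' := run (startStmt c (e (p 0))) none) rfl).trans ?_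
      have hS : (fun _ : K' => ([] : List Γ')) = K'.elim [] [] [] [] := by
        funext k
        cases k <;> rfl
      rw [hS]
      refine leads_push.trans ?_
      rw [K'.elim_update_main]
      refine leads_push.trans ?_
      rw [K'.elim_update_main]
      have := leads_compute (d := d) hc hg p 0 [] (p 0) (st 0)
      rw [← hst 0] at this
      simpa [h0] using this
    | succ n ih =>
      refine ih.trans ?_
      refine (leads_silent_none (s' := run (inStmt c (e (p (n + 1)))) none) rfl).trans ?_
      have := leads_compute (d := d) hc hg p (n + 1)
        ((List.range (n + 1)).flatMap fun i => (d (g (p i) (st i))).toList) (p (n + 1)) (st (n + 1))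
      rw [← hst (n + 1)] at this
      rw [List.range_succ (n := n + 1), List.flatMap_append]
      simpa using this
  cases n with
  | zero => exact ⟨0, rfl⟩
  | succ n =>
    obtain ⟨t, -, -, -, ht⟩ := key n (ofCfg (machine c e d J).init)
      ⟨rfl, rfl, fun _ => StackTape.nil, rfl⟩
    refine ⟨t, ?_⟩
    rw [← ofCfg_iterate] at ht
    exact ht

end Ctl

end TTE

namespace TTE

open Turing Encodable

/-! ## Machines from primitive recursive functions on prefixes -/

/-- The prefix of length `n` of the sequence `p`. -/
def pre {A : Type} (p : ℕ → A) (n : ℕ) : List A := (List.range n).map p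

section

variable {A : Type} {p : ℕ → A}

@[simp]
theorem length_pre (n : ℕ) : (pre p n).length = n := by simp [pre]

theorem pre_succ (n : ℕ) : pre p (n + 1) = pre p n ++ [p n] := by
  simp [pre, List.range_succ]

theorem getElem?_pre (n i : ℕ) : (pre p n)[i]? = if i < n then some (p i) else none := by
  split_ifs with h
  · simp [pre, h]
  · simp [pre, not_lt.1 h]

theorem take_pre {m n : ℕ} (h : m ≤ n) : (pre p n).take m = pre p m := by
  rw [pre, ← List.map_take, List.take_range, min_eq_left h, pre]

theorem prefix_pre {m n : ℕ} (h : m ≤ n) : pre p m <+: pre p n := by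
  rw [← take_pre h]
  exact List.take_prefix _ _

end

theorem primrec_two_pow : Primrec fun n : ℕ => 2 ^ n := by
  have h : Primrec₂ ((· ^ ·) : ℕ → ℕ → ℕ) := Primrec₂.unpaired'.1 Nat.Primrec.pow
  exact h.comp (Primrec.const 2) Primrec.id

theorem exists_code_pair {f g : ℕ → ℕ → ℕ} (hf : Primrec₂ f) (hg : Primrec₂ g) :
    ∃ c : ToPartrec.Code, ∀ x s, [f x s, g x s] ∈ c.eval [x, s] := by
  have key : ∀ {f : ℕ → ℕ → ℕ}, Primrec₂ f →
      ∃ c : ToPartrec.Code, ∀ x s, c.eval [x, s] = Part.some [f x s] := by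
    intro f hf
    obtain ⟨c, hc⟩ := ToPartrec.Code.exists_code (Nat.Partrec'.prim (Nat.Primrec'.prim_iff₂.2 hf))
    refine ⟨c, fun x s => ?_⟩
    exact (hc ⟨[x, s], rfl⟩).trans (Part.map_some _ _)
  obtain ⟨c, hc⟩ := key hf
  obtain ⟨c', hc'⟩ := key hg
  refine ⟨c.cons c', fun x s => ?_⟩
  simp [hc, hc']

/-- A primitive recursive left inverse of a function on a finite type. -/
theorem exists_primrec_leftInverse {A : Type} [Finite A] [Primcodable A] {c : A → ℕ}
    (hc : Function.Injective c) : ∃ r : ℕ → Option A, Primrec r ∧ ∀ a, r (c a) = some a := by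
  classical
  have := Fintype.ofFinite A
  let L : List A := Finset.univ.toList
  refine ⟨fun x => L[(L.map c).idxOf x]?,
    (Primrec.list_getElem?₁ L).comp (Primrec.list_idxOf₁ (L.map c)), fun a => ?_⟩
  have hmem : c a ∈ L.map c := List.mem_map_of_mem (by simp [L])
  have hlt := List.idxOf_lt_length_of_mem hmem
  have h := List.getElem_idxOf hlt
  rw [List.getElem_map] at h
  exact (List.getElem?_eq_getElem (by simpa using hlt)).trans (congrArg some (hc h))

theorem exists_machine_of_primrec {A : Type} [Finite A] [Primcodable A] {H : List A → Option A}
    (hH : Primrec H) : ∃ M : Machine A, ∀ p n, ∃ t,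
      (M.run p t).output = (List.range n).flatMap fun i => (H (pre p (i + 1))).toList := by
  obtain ⟨r, hr, hra⟩ := exists_primrec_leftInverse (A := A) (c := fun a => 2 ^ encode a - 1) (by
    intro a b h
    have h1 := Nat.one_le_two_pow (n := encode a)
    have h2 := Nat.one_le_two_pow (n := encode b)
    have : 2 ^ encode a = 2 ^ encode b := by simp only at h; lia
    exact encode_injective (Nat.pow_right_injective le_rfl this))
  let upd : ℕ → ℕ → List A := fun x s => ((decode (α := List A) s).getD []) ++ (r x).toList
  have hupd : Primrec₂ upd := Primrec.list_append.comp₂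
    (Primrec.option_getD.comp (Primrec.decode.comp Primrec.snd) (Primrec.const [])).to₂
    (Primrec.optionToList.comp (hr.comp Primrec.fst)).to₂
  obtain ⟨c, hc⟩ := exists_code_pair
    (f := fun x s => 2 ^ encode (H (upd x s)) - 1) (g := fun x s => encode (upd x s))
    (Primrec.nat_sub.comp₂ (primrec_two_pow.comp₂ (Primrec.encode.comp₂ (hH.comp₂ hupd)))
      (Primrec₂.const 1)) (Primrec.encode.comp₂ hupd)
  obtain ⟨J, hJ⟩ := (Set.finite_range fun x : Option A => encode x).bddAbove
  refine ⟨Ctl.machine c encode (fun j => (decode (α := Option A) j).join) J, fun p n => ?_⟩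
  obtain ⟨t, ht⟩ := Ctl.exists_output (c := c) (e := encode)
    (d := fun j => (decode (α := Option A) j).join) (J := J)
    (f := fun a s => encode (upd (2 ^ encode a - 1) s))
    (g := fun a s => encode (H (upd (2 ^ encode a - 1) s)))
    (fun a s => hc _ _) (fun a s => hJ ⟨_, rfl⟩) p (fun n => encode (pre p n)) (by simp [pre])
    (fun n => by simp [upd, hra, pre_succ]) n
  refine ⟨t, ht.trans ?_⟩
  simp only [upd, hra, encodek, Option.getD_some, Option.toList_some, ← pre_succ, Option.join_some]

theorem Machine.computes_unique {A : Type} {M : Machine A} {p q q' : ℕ → A}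
    (h : M.Computes p q) (h' : M.Computes p q') : q = q' := by
  have step : ∀ t, (M.run p t).output <+: (M.run p (t + 1)).output := by
    intro t
    rw [Machine.run, Machine.run, Function.iterate_succ_apply']
    exact List.prefix_append _ _
  have pref : ∀ s t, s ≤ t → (M.run p s).output <+: (M.run p t).output := by
    intro s t hst
    induction hst with
    | refl => exact List.prefix_rfl
    | step _ ih => exact ih.trans (step _)
  funext n
  obtain ⟨t, ht⟩ := h n
  obtain ⟨t', ht'⟩ := h' n
  have key : ∀ {s x}, (M.run p s).output[n]? = some x → s ≤ max t t' →
      (M.run p (max t t')).output[n]? = some x := by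
    intro s x hs hle
    obtain ⟨l, hl⟩ := pref _ _ hle
    rw [← hl, List.getElem?_append_left (List.getElem?_eq_some_iff.1 hs).1, hs]
  have := (key ht (le_max_left _ _)).symm.trans (key ht' (le_max_right _ _))
  simpa using this

/-- The partial function computed by a machine. -/
noncomputable def Machine.toPFun {A : Type} (M : Machine A) : (ℕ → A) →. (ℕ → A) := fun p =>
  ⟨∃ q, M.Computes p q, Exists.choose⟩

theorem Machine.mem_toPFun {A : Type} {M : Machine A} {p q : ℕ → A} :
    q ∈ M.toPFun p ↔ M.Computes p q := by
  constructor
  · rintro ⟨h, rfl⟩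
    exact h.choose_spec
  · intro h
    exact ⟨⟨q, h⟩, computes_unique (Exists.choose_spec (⟨q, h⟩ : ∃ q, M.Computes p q)) h⟩

/-- A sufficient condition for relative computability: a primitive recursive function on the
prefixes of the input yields, symbol by symbol, a name of the value. -/
theorem computableWrt_of_primrec {A : Type} [Finite A] [Primcodable A] {M : Type u} {M' : Type v}
    {γ : MultiRep A M} {γ' : MultiRep A M'} {f : M →. M'} {H : List A → Option A}
    (hH : Primrec H)
    (h : ∀ p x, x ∈ γ p → ∀ y ∈ f x, ∃ q, y ∈ γ' q ∧ ∀ n, ∃ k,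
      ((List.range k).flatMap fun i => (H (pre p (i + 1))).toList)[n]? = some (q n)) :
    ComputableWrt γ γ' f := by
  obtain ⟨M, hM⟩ := exists_machine_of_primrec hH
  refine ⟨M.toPFun, ⟨M, fun p q => M.mem_toPFun⟩, fun p x hx y hy => ?_⟩
  obtain ⟨q, hq, hk⟩ := h p x hx y hy
  refine ⟨q, M.mem_toPFun.2 fun n => ?_, hq⟩
  obtain ⟨k, hk⟩ := hk n
  obtain ⟨t, ht⟩ := hM p k
  exact ⟨t, ht ▸ hk⟩

end TTE

namespace TTE

/-! ## Occurrences in words and sequences -/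

section Occurrences

variable {A : Type} [Zero A]

theorem getElem?_flatMap_append (v s : List A) (t : ℕ) (ht : t < v.length) :
    (v.flatMap (fun a => [a, 0]) ++ s)[2 * t]? = v[t]? := by
  induction v generalizing t with
  | nil => simp at ht
  | cons a v ih =>
    cases t with
    | zero => simp
    | succ t =>
      have := ih t (by simpa using ht)
      simpa [show 2 * (t + 1) = 2 * t + 1 + 1 by lia] using this

variable [One A]

/-- A block of an output sequence: a wrapped word or the filler `1`. -/
def block : Option (List A) → List A
  | none => [1]
  | some w => iota w

theorem one_le_length_block (o : Option (List A)) : 1 ≤ (block o).length := by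
  cases o <;> simp [block, iota]

theorem wordTuple_eq_flatMap_block (us : List (List A)) :
    wordTuple us = (us.map some).flatMap block := by
  simp [wordTuple, List.flatMap_map, block]

theorem length_iota (v : List A) : (iota v).length = 2 * v.length + 5 := by
  simp only [iota, List.length_append, List.length_cons, List.length_nil, List.length_flatMap,
    List.map_const', List.sum_replicate, smul_eq_mul]
  lia

theorem getD_iota_append (v s : List A) (t : ℕ) (ht : t < v.length) :
    (iota v ++ s).getD (3 + 2 * t) 0 = v[t] := by
  have := getElem?_flatMap_append v ([1, 1] ++ s) t ht
  rw [List.getElem?_eq_getElem ht] at this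
  rw [List.getD_eq_getElem?_getD, show 3 + 2 * t = 2 * t + 1 + 1 + 1 by lia]
  simpa [iota] using congrArg (Option.getD · 0) this

theorem getElem?_flatMap_block_zero [NeZero (1 : A)] (bs : List (Option (List A))) :
    (bs.flatMap block)[0]? ≠ some 0 := by
  have h10 : (1 : A) ≠ 0 := NeZero.ne 1
  rcases bs with _ | ⟨_ | w, bs⟩ <;> simp [block, iota, h10]

theorem getElem?_flatMap_block_one [NeZero (1 : A)] (bs : List (Option (List A))) :
    (bs.flatMap block)[1]? ≠ some 0 := by
  have h10 : (1 : A) ≠ 0 := NeZero.ne 1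
  rcases bs with _ | ⟨_ | w, bs⟩
  · simp
  · simpa [block] using getElem?_flatMap_block_zero bs
  · simp [block, iota, h10]

variable [DecidableEq A]

/-- The list that consists of the word `v` such that `ι(v)` is a prefix of `x`, if there is one. -/
def parseHead (x : List A) : List (List A) :=
  (((List.range (x.length + 1)).map fun k => (List.range k).map fun t => x.getD (3 + 2 * t) 0).filter
    fun v => iota v = x.take (iota v).length).head?.toList

/-- The list of the words `v` with `v ≪ w`, ordered by the position of `ι(v)` in `w`. -/
def occ (w : List A) : List (List A) := w.tails.flatMap parseHead

theorem occ_cons (a : A) (w : List A) : occ (a :: w) = parseHead (a :: w) ++ occ w := by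
  simp [occ]

variable [NeZero (1 : A)]

theorem mem_parseHead {v x : List A} : v ∈ parseHead x ↔ iota v <+: x := by
  have h1 : ∀ {v}, v ∈ parseHead x → iota v <+: x := by
    intro v hv
    rw [parseHead, Option.mem_toList] at hv
    have := List.of_mem_filter (List.mem_of_head? hv)
    rw [List.prefix_iff_eq_take]
    simpa using this
  refine ⟨h1, fun h => ?_⟩
  obtain ⟨s, rfl⟩ := h
  have hv : v ∈ (((List.range ((iota v ++ s).length + 1)).map fun k =>
      (List.range k).map fun t => (iota v ++ s).getD (3 + 2 * t) 0).filter
        fun v' => iota v' = (iota v ++ s).take (iota v').length) := by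
    rw [List.mem_filter, List.mem_map]
    refine ⟨⟨v.length, ?_, ?_⟩, by simp⟩
    · rw [List.mem_range, List.length_append, length_iota]
      lia
    · refine List.ext_getElem (by simp) fun t ht ht' => ?_
      rw [List.getElem_map, List.getElem_range, getD_iota_append v s t ht']
  obtain ⟨v', hv'⟩ := Option.isSome_iff_exists.1 (List.isSome_head?.2 (List.ne_nil_of_mem hv))
  have hmem : v' ∈ parseHead (iota v ++ s) := by
    rw [parseHead, hv']
    simp
  obtain ⟨s', hs'⟩ := h1 hmem
  rwa [(iota_append_inj hs').1] at hmem

theorem parseHead_iota_append (v s : List A) : parseHead (iota v ++ s) = [v] := by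
  have hv := mem_parseHead.2 (List.prefix_append (iota v) s)
  rw [parseHead, Option.mem_toList] at hv
  rw [parseHead, hv, Option.toList_some]

theorem mem_occ {v w : List A} : v ∈ occ w ↔ OccursW v w := by
  simp only [occ, List.mem_flatMap, List.mem_tails, mem_parseHead, OccursW,
    List.infix_iff_prefix_suffix, and_comm]

theorem occ_nil : occ ([] : List A) = [] := by
  refine List.eq_nil_iff_forall_not_mem.2 fun v hv => ?_
  have := (mem_occ.1 hv).length_le
  rw [length_iota] at this
  simp at this

theorem parseHead_eq_nil {x : List A} (h : ¬ [1, 1, 0] <+: x) : parseHead x = [] := by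
  refine List.eq_nil_iff_forall_not_mem.2 fun v hv => h ?_
  refine List.IsPrefix.trans ?_ (mem_parseHead.1 hv)
  simp [iota]

theorem occ_cons_of_not_prefix {a : A} {w : List A} (h : ¬ [1, 1, 0] <+: a :: w) :
    occ (a :: w) = occ w := by
  rw [occ_cons, parseHead_eq_nil h, List.nil_append]

theorem occ_one_cons {s : List A} (h : s[1]? ≠ some 0) : occ (1 :: s) = occ s := by
  refine occ_cons_of_not_prefix ?_
  rintro ⟨t, ht⟩
  simp only [List.cons_append, List.nil_append, List.cons.injEq, true_and] at ht
  subst ht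
  simp at h

theorem occ_flatMap_append {s : List A} (h0 : s[0]? ≠ some 0) (h1 : s[1]? ≠ some 0)
    (v : List A) : occ (0 :: (v.flatMap (fun a => [a, 0]) ++ ([1, 1] ++ s))) = occ s := by
  have h10 : (1 : A) ≠ 0 := NeZero.ne 1
  have zero : ∀ x : List A, occ (0 :: x) = occ x := fun x =>
    occ_cons_of_not_prefix (by simp [h10])
  rw [zero]
  induction v with
  | nil =>
    simp only [List.flatMap_nil, List.nil_append, List.cons_append]
    rw [occ_one_cons (by simpa using h0), occ_one_cons h1]
  | cons a v ih =>
    simp only [List.flatMap_cons, List.cons_append, List.nil_append]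
    rw [occ_cons_of_not_prefix (by simp [h10]), zero]
    exact ih

theorem occ_iota_append {s : List A} (h0 : s[0]? ≠ some 0) (h1 : s[1]? ≠ some 0) (v : List A) :
    occ (iota v ++ s) = v :: occ s := by
  have h10 : (1 : A) ≠ 0 := NeZero.ne 1
  have e : iota v ++ s = 1 :: 1 :: 0 :: (v.flatMap (fun a => [a, 0]) ++ ([1, 1] ++ s)) := by
    simp [iota]
  rw [e, occ_cons, ← e, parseHead_iota_append, occ_cons_of_not_prefix (by simp),
    occ_flatMap_append h0 h1]
  rfl

theorem occ_flatMap_block (bs : List (Option (List A))) :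
    occ (bs.flatMap block) = bs.filterMap id := by
  induction bs with
  | nil => simp [occ_nil]
  | cons b bs ih =>
    rw [List.flatMap_cons]
    cases b with
    | none =>
      simp only [block, List.cons_append, List.nil_append]
      rw [occ_one_cons (getElem?_flatMap_block_one bs), ih]
      simp
    | some w =>
      simp only [block]
      rw [occ_iota_append (getElem?_flatMap_block_zero bs) (getElem?_flatMap_block_one bs), ih]
      simp

theorem occ_wordTuple (us : List (List A)) : occ (wordTuple us) = us := by
  rw [wordTuple_eq_flatMap_block, occ_flatMap_block]
  simp [List.filterMap_map]

theorem occursW_wordTuple {v : List A} {us : List (List A)} :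
    OccursW v (wordTuple us) ↔ v ∈ us := by
  rw [← mem_occ, occ_wordTuple]

end Occurrences

section Sequences

variable {A : Type} [Zero A] [One A]

theorem occurs_iff_occursW_pre {v : List A} {p : ℕ → A} :
    Occurs v p ↔ ∃ n, OccursW v (pre p n) := by
  constructor
  · rintro ⟨k, hk⟩
    refine ⟨k + (iota v).length, pre p k, [], ?_⟩
    refine List.ext_getElem? fun i => ?_
    rw [getElem?_pre, List.append_nil, List.getElem?_append, getElem?_pre, length_pre]
    by_cases h : i < k
    · rw [if_pos h, if_pos h, if_pos (by lia)]
    · rw [if_neg h]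
      by_cases h' : i < k + (iota v).length
      · rw [if_pos h', List.getElem?_eq_getElem (by lia), hk (i - k) (by lia)]
        congr 2
        lia
      · rw [if_neg h', List.getElem?_eq_none (by lia)]
  · rintro ⟨n, x, y, h⟩
    refine ⟨x.length, fun i hi => ?_⟩
    have h' := congrArg (fun l => l[x.length + i]?) h
    simp only [getElem?_pre] at h'
    rw [List.append_assoc, List.getElem?_append_right (by lia), Nat.add_sub_cancel_left,
      List.getElem?_append_left hi, List.getElem?_eq_getElem hi] at h'
    split_ifs at h'
    · simpa using h'

theorem OccursW.mono {v w w' : List A} (h : OccursW v w) (hw : w <:+: w') : OccursW v w' :=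
  h.trans hw

/-- The first blocks of a sequence of blocks. -/
def blocks (E : ℕ → Option (List A)) (m : ℕ) : List A :=
  (List.range m).flatMap fun i => block (E i)

/-- The concatenation of a sequence of blocks. -/
def blockSeq (E : ℕ → Option (List A)) : ℕ → A := fun j => (blocks E (j + 1)).getD j 1

theorem blocks_succ (E : ℕ → Option (List A)) (m : ℕ) :
    blocks E (m + 1) = blocks E m ++ block (E m) := by
  simp [blocks, List.range_succ]

theorem le_length_blocks (E : ℕ → Option (List A)) (m : ℕ) : m ≤ (blocks E m).length := by
  induction m with
  | zero => simp
  | succ m ih =>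
    have := one_le_length_block (E m)
    rw [blocks_succ, List.length_append]
    lia

theorem blocks_prefix (E : ℕ → Option (List A)) {m n : ℕ} (h : m ≤ n) :
    blocks E m <+: blocks E n := by
  induction h with
  | refl => exact List.prefix_rfl
  | step _ ih => exact ih.trans (blocks_succ E _ ▸ List.prefix_append _ _)

theorem getElem?_blocks (E : ℕ → Option (List A)) {m j : ℕ} (h : j < (blocks E m).length) :
    (blocks E m)[j]? = some (blockSeq E j) := by
  have hj : j < (blocks E (j + 1)).length := le_length_blocks E (j + 1)
  have h1 : (blocks E (j + 1))[j]? = some (blockSeq E j) := by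
    rw [blockSeq, List.getD_eq_getElem _ _ hj, List.getElem?_eq_getElem hj]
  rcases le_total m (j + 1) with hm | hm
  · obtain ⟨t, ht⟩ := blocks_prefix E hm
    rw [← h1, ← ht, List.getElem?_append_left h]
  · obtain ⟨t, ht⟩ := blocks_prefix E hm
    rw [← h1, ← ht, List.getElem?_append_left hj]

theorem pre_blockSeq (E : ℕ → Option (List A)) (m : ℕ) :
    pre (blockSeq E) (blocks E m).length = blocks E m := by
  refine List.ext_getElem? fun j => ?_
  rw [getElem?_pre]
  split_ifs with h
  · rw [getElem?_blocks E h]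
  · rw [List.getElem?_eq_none (by lia)]

variable [NeZero (1 : A)]

theorem occurs_blockSeq {E : ℕ → Option (List A)} {v : List A} :
    Occurs v (blockSeq E) ↔ ∃ m, E m = some v := by
  classical
  have key : ∀ m, occ (blocks E m) = ((List.range m).map E).filterMap id := by
    intro m
    rw [← occ_flatMap_block, List.flatMap_map, blocks]
  rw [occurs_iff_occursW_pre]
  constructor
  · rintro ⟨n, hn⟩
    have h := hn.mono (prefix_pre (le_length_blocks E n)).isInfix
    rw [pre_blockSeq, ← mem_occ, key] at h
    simp only [List.filterMap_map, List.mem_filterMap, Function.comp_apply, id_eq] at h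
    obtain ⟨m, -, hm⟩ := h
    exact ⟨m, hm⟩
  · rintro ⟨m, hm⟩
    refine ⟨(blocks E (m + 1)).length, ?_⟩
    rw [pre_blockSeq, ← mem_occ, key]
    simp only [List.filterMap_map, List.mem_filterMap, Function.comp_apply, id_eq]
    exact ⟨m, by simp, hm⟩

end Sequences

/-! ## Enumerations -/

section Enumerations

open Encodable Filter

variable {A : Type} [Encodable A]

open Classical in
/-- The word that is listed in stage `m` of the enumeration given by `R`, where `l` is a prefix
of the input. -/
noncomputable def stage (R : List A → List A → Prop) (l : List A) (m : ℕ) : Option (List A) :=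
  (decode (α := List A) m.unpair.1).bind fun w => if R w (l.take m) then some w else none

theorem stage_pre (R : List A → List A → Prop) (p : ℕ → A) {m n : ℕ} (h : m ≤ n) :
    stage R (pre p n) m = stage R (pre p m) m := by
  rw [stage, stage, take_pre h, take_pre le_rfl]

variable [Zero A] [One A]

/-- The sequence that lists the words `w` such that `R w l` for some prefix `l` of `p`. -/
noncomputable def enumSeq (R : List A → List A → Prop) (p : ℕ → A) : ℕ → A :=
  blockSeq fun m => stage R (pre p m) m

/-- The symbol number `j` of the enumeration, computed from a prefix of the input. -/
noncomputable def enumSym (R : List A → List A → Prop) (l : List A) (j : ℕ) : A :=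
  (blocks (stage R l) (j + 1)).getD j 1

theorem enumSym_pre (R : List A → List A → Prop) (p : ℕ → A) {j n : ℕ} (h : j ≤ n) :
    enumSym R (pre p n) j = enumSeq R p j := by
  have : blocks (stage R (pre p n)) (j + 1) = blocks (fun m => stage R (pre p m) m) (j + 1) := by
    refine congrArg List.flatten (List.map_congr_left fun m hm => ?_)
    rw [stage_pre R p (by rw [List.mem_range] at hm; lia)]
  rw [enumSym, enumSeq, blockSeq, this]

theorem occurs_enumSeq [NeZero (1 : A)] {R : List A → List A → Prop} {p : ℕ → A}
    {P : List A → Prop} (sound : ∀ v m, R v (pre p m) → P v)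
    (complete : ∀ v, P v → ∀ᶠ m in atTop, R v (pre p m)) (v : List A) :
    Occurs v (enumSeq R p) ↔ P v := by
  rw [enumSeq, occurs_blockSeq]
  constructor
  · rintro ⟨m, hm⟩
    rw [stage, take_pre le_rfl] at hm
    simp only [Option.bind_eq_some_iff, Option.ite_none_right_eq_some, Option.some.injEq] at hm
    obtain ⟨w, -, hR, rfl⟩ := hm
    exact sound _ _ hR
  · intro hv
    obtain ⟨k, hk⟩ := eventually_atTop.1 (complete v hv)
    refine ⟨Nat.pair (encode v) k, ?_⟩
    rw [stage, take_pre le_rfl]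
    simp [hk _ (Nat.right_le_pair _ _)]

end Enumerations

/-! ## Subsequences -/

section Subsequences

open Filter

variable {A : Type}

/-- The prefix of the subsequence `p ∘ φ` that can be computed from a prefix `l` of `p`. -/
def sel (φ : ℕ → ℕ) (l : List A) : List A :=
  (List.range l.length).filterMap fun j => l[φ j]?

theorem sel_pre {φ : ℕ → ℕ} (hφ : StrictMono φ) (p : ℕ → A) {n m : ℕ}
    (hm : ∀ j, φ j < n ↔ j < m) : sel φ (pre p n) = pre (p ∘ φ) m := by
  have hmn : m ≤ n := by
    by_contra h
    exact absurd ((hm n).2 (by lia)) (not_lt.2 hφ.le_apply)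
  have key : ∀ k, (List.range k).filterMap (fun j => (pre p n)[φ j]?) =
      pre (p ∘ φ) (min k m) := by
    intro k
    induction k with
    | zero => simp [pre]
    | succ k ih =>
      rw [List.range_succ, List.filterMap_append, ih]
      by_cases h : k < m
      · rw [show min (k + 1) m = min k m + 1 by lia, pre_succ, show min k m = k by lia]
        simp [getElem?_pre, (hm k).2 h]
      · rw [show min (k + 1) m = min k m by lia]
        simp [getElem?_pre, hm k, h]
  rw [sel, length_pre, key, min_eq_right hmn]

theorem exists_lt_iff_lt {φ : ℕ → ℕ} (hφ : StrictMono φ) (n : ℕ) :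
    ∃ m, ∀ j, φ j < n ↔ j < m := by
  have hex : ∃ j, n ≤ φ j := ⟨n, hφ.le_apply⟩
  refine ⟨Nat.find hex, fun j => ⟨fun h => ?_, fun h => not_le.1 (Nat.find_min hex h)⟩⟩
  by_contra h'
  exact absurd ((Nat.find_spec hex).trans (hφ.monotone (not_lt.1 h'))) (not_le.2 h)

variable [Zero A] [One A]

theorem occurs_of_occursW_sel {φ : ℕ → ℕ} (hφ : StrictMono φ) {p : ℕ → A} {n : ℕ} {v : List A}
    (h : OccursW v (sel φ (pre p n))) : Occurs v (p ∘ φ) := by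
  obtain ⟨m, hm⟩ := exists_lt_iff_lt hφ n
  rw [sel_pre hφ p hm] at h
  exact occurs_iff_occursW_pre.2 ⟨m, h⟩

theorem eventually_occursW_sel {φ : ℕ → ℕ} (hφ : StrictMono φ) {p : ℕ → A} {v : List A}
    (h : Occurs v (p ∘ φ)) : ∀ᶠ n in atTop, OccursW v (sel φ (pre p n)) := by
  obtain ⟨k, hk⟩ := occurs_iff_occursW_pre.1 h
  refine eventually_atTop.2 ⟨φ k, fun n hn => ?_⟩
  obtain ⟨m, hm⟩ := exists_lt_iff_lt hφ n
  rw [sel_pre hφ p hm]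
  refine hk.mono (prefix_pre ?_).isInfix
  by_contra hlt
  exact absurd ((hm m).1 ((hφ (not_le.1 hlt)).trans_le hn)) (lt_irrefl _)

end Subsequences

end TTE

namespace TTE

open Filter

/-! ## Points of base elements -/

section Points

variable {A : Type}

/-- The point `x` lies in the base element with the name `w`. -/
def InBase (X : EffSpace.{u} A) (w : List A) (x : X.carrier) : Prop := ∃ U ∈ X.ν w, x ∈ U

theorem InBase.mem_dom {X : EffSpace.{u} A} {w : List A} {x : X.carrier} (h : InBase X w x) :
    w ∈ X.ν.Dom := by
  obtain ⟨U, hU, -⟩ := h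
  exact Part.dom_iff_mem.2 ⟨U, hU⟩

theorem inBase_iff_of_mem {X : EffSpace.{u} A} {w : List A} {U : Set X.carrier} (hU : U ∈ X.ν w)
    {x : X.carrier} : InBase X w x ↔ x ∈ U :=
  ⟨fun ⟨_, hV, hx⟩ => Part.mem_unique hV hU ▸ hx, fun hx => ⟨U, hU, hx⟩⟩

theorem exists_inBase (X : EffSpace.{u} A) (x : X.carrier) : ∃ w, InBase X w x := by
  obtain ⟨U, ⟨w, hU⟩, hx, -⟩ := X.isBase.exists_subset_of_mem_open (Set.mem_univ x) isOpen_univ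
  exact ⟨w, U, hU, hx⟩

theorem isOpen_inBase (X : EffSpace.{u} A) (w : List A) : IsOpen {x | InBase X w x} := by
  by_cases h : w ∈ X.ν.Dom
  · obtain ⟨U, hU⟩ := Part.dom_iff_mem.1 h
    have : {x | InBase X w x} = U := Set.ext fun x => inBase_iff_of_mem hU
    exact this ▸ X.isBase.isOpen ⟨w, hU⟩
  · convert isOpen_empty
    exact Set.eq_empty_of_forall_notMem fun x hx => h (InBase.mem_dom hx)

/-- Every compact set is covered by finitely many base elements. -/
theorem exists_list_cover {X : EffSpace.{u} A} {K : Set X.carrier} (hK : IsCompact K) :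
    ∃ F : List (List A), ∀ x ∈ K, ∃ v ∈ F, InBase X v x := by
  obtain ⟨t, ht⟩ := hK.elim_finite_subcover (fun w => {x | InBase X w x})
    (fun w => isOpen_inBase X w) fun x _ => Set.mem_iUnion.2 (exists_inBase X x)
  refine ⟨t.toList, fun x hx => ?_⟩
  simpa using ht hx

variable [Zero A] [One A]

theorem mem_kappaTilde_iff {X : EffSpace.{u} A} {K : Set X.carrier} {s : ℕ → A} :
    K ∈ kappaTilde X s ↔ ∀ w, Occurs w s ↔
      (∀ v, OccursW v w → ∃ x ∈ K, InBase X v x) ∧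
        ∀ x ∈ K, ∃ v, OccursW v w ∧ InBase X v x := by
  refine forall_congr' fun w => iff_congr Iff.rfl ?_
  constructor
  · rintro ⟨⟨W, ⟨hd, rfl⟩, hW⟩, hm⟩
    refine ⟨fun v hv => ?_, fun x hx => ?_⟩
    · obtain ⟨U, hU, x, hxU, hxK⟩ := hm v hv
      exact ⟨x, hxK, U, hU, hxU⟩
    · obtain ⟨U, ⟨v, hv, hU⟩, hxU⟩ := hW hx
      exact ⟨v, hv, U, hU, hxU⟩
  · rintro ⟨hm, hc⟩
    refine ⟨⟨_, ⟨fun v hv => ?_, rfl⟩, fun x hx => ?_⟩, fun v hv => ?_⟩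
    · obtain ⟨x, -, hx⟩ := hm v hv
      exact hx.mem_dom
    · obtain ⟨v, hv, U, hU, hxU⟩ := hc x hx
      exact ⟨U, ⟨v, hv, hU⟩, hxU⟩
    · obtain ⟨x, hxK, U, hU, hxU⟩ := hm v hv
      exact ⟨U, hU, x, hxU, hxK⟩

theorem mem_Delta_iff {X : EffSpace.{u} A} {t : ℕ → A} :
    X ∈ Delta t ↔ (∀ z, Occurs z (comp 2 0 t) ↔
          ∃ w, (w ∈ X.ν.Dom ∧ z = wordTuple [w, [1]]) ∨ (w ∉ X.ν.Dom ∧ z = wordTuple [w, [0]])) ∧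
    ∃ S : Set (List A × List A × List A),
      (∀ u v w, (u, v, w) ∈ S → u ∈ X.ν.Dom ∧ v ∈ X.ν.Dom ∧ w ∈ X.ν.Dom) ∧
      (∀ z, Occurs z (comp 2 1 t) ↔ ∃ u v w, (u, v, w) ∈ S ∧ z = wordTuple [u, v, w]) ∧
      ∀ u v, u ∈ X.ν.Dom → v ∈ X.ν.Dom → ∀ x,
        InBase X u x ∧ InBase X v x ↔ ∃ w, (u, v, w) ∈ S ∧ InBase X w x := by
  refine and_congr Iff.rfl (exists_congr fun S => and_congr Iff.rfl (and_congr Iff.rfl ?_))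
  refine forall_congr' fun u => forall_congr' fun v => ?_
  constructor
  · intro h hu hv x
    have := Set.ext_iff.1 (h _ (Part.get_mem hu) _ (Part.get_mem hv)) x
    rw [inBase_iff_of_mem (Part.get_mem hu), inBase_iff_of_mem (Part.get_mem hv)]
    refine this.trans ⟨?_, ?_⟩
    · rintro ⟨W, ⟨w, hS, hW⟩, hx⟩
      exact ⟨w, hS, W, hW, hx⟩
    · rintro ⟨w, hS, W, hW, hx⟩
      exact ⟨W, ⟨w, hS, hW⟩, hx⟩
  · intro h U hU V hV
    ext x
    rw [Set.mem_inter_iff, ← inBase_iff_of_mem hU, ← inBase_iff_of_mem hV,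
      h (Part.dom_iff_mem.2 ⟨U, hU⟩) (Part.dom_iff_mem.2 ⟨V, hV⟩) x]
    constructor
    · rintro ⟨w, hS, W, hW, hx⟩
      exact ⟨W, ⟨w, hS, hW⟩, hx⟩
    · rintro ⟨W, ⟨w, hS, hW⟩, hx⟩
      exact ⟨w, hS, W, hW, hx⟩

variable [NeZero (1 : A)]

theorem occurs_dom_one {X : EffSpace.{u} A} {t : ℕ → A} (h : X ∈ Delta t) (u : List A) :
    Occurs (wordTuple [u, [1]]) (comp 2 0 t) ↔ u ∈ X.ν.Dom := by
  have h10 : (1 : A) ≠ 0 := NeZero.ne 1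
  rw [h.1]
  constructor
  · rintro ⟨w, ⟨hw, e⟩ | ⟨-, e⟩⟩
    · have := wordTuple_injective e
      simp only [List.cons.injEq, and_true] at this
      exact this ▸ hw
    · have := wordTuple_injective e
      simp [h10] at this
  · exact fun hu => ⟨u, Or.inl ⟨hu, rfl⟩⟩

theorem occurs_dom_zero {X : EffSpace.{u} A} {t : ℕ → A} (h : X ∈ Delta t) (u : List A) :
    Occurs (wordTuple [u, [0]]) (comp 2 0 t) ↔ u ∉ X.ν.Dom := by
  have h10 : (1 : A) ≠ 0 := NeZero.ne 1
  rw [h.1]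
  constructor
  · rintro ⟨w, ⟨-, e⟩ | ⟨hw, e⟩⟩
    · have := wordTuple_injective e
      simp [h10.symm] at this
    · have := wordTuple_injective e
      simp only [List.cons.injEq, and_true] at this
      exact this ▸ hw
  · exact fun hu => ⟨u, Or.inr ⟨hu, rfl⟩⟩

variable {X : EffSpace.{u} A} {K : Set X.carrier} {s : ℕ → A}

theorem occurs_wordTuple_filter (h : K ∈ kappaTilde X s) {F : List (List A)}
    (hF : ∀ x ∈ K, ∃ v ∈ F, InBase X v x) [DecidablePred fun v => ∃ x ∈ K, InBase X v x] :
    Occurs (wordTuple (F.filter fun v => ∃ x ∈ K, InBase X v x)) s := by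
  classical
  rw [mem_kappaTilde_iff.1 h]
  simp only [occursW_wordTuple, List.mem_filter, decide_eq_true_eq]
  refine ⟨fun v hv => hv.2, fun x hx => ?_⟩
  obtain ⟨v, hv, hvx⟩ := hF x hx
  exact ⟨v, ⟨hv, x, hx, hvx⟩, hvx⟩

theorem exists_occurs_subset_iff (h : K ∈ kappaTilde X s) (F : List (List A)) :
    (∃ w, Occurs w s ∧ ∀ v, OccursW v w → v ∈ F) ↔ ∀ x ∈ K, ∃ v ∈ F, InBase X v x := by
  classical
  constructor
  · rintro ⟨w, hw, hF⟩ x hx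
    obtain ⟨v, hv, hvx⟩ := ((mem_kappaTilde_iff.1 h w).1 hw).2 x hx
    exact ⟨v, hF v hv, hvx⟩
  · intro hF
    refine ⟨_, occurs_wordTuple_filter h hF, fun v hv => ?_⟩
    rw [occursW_wordTuple] at hv
    exact List.mem_of_mem_filter hv

theorem exists_occurs_mem_iff (h : K ∈ kappaTilde X s) (hK : IsCompact K) (u : List A) :
    (∃ w, Occurs w s ∧ OccursW u w) ↔ ∃ x ∈ K, InBase X u x := by
  classical
  constructor
  · rintro ⟨w, hw, hu⟩
    exact ((mem_kappaTilde_iff.1 h w).1 hw).1 u hu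
  · rintro hu
    obtain ⟨F, hF⟩ := exists_list_cover hK
    refine ⟨_, occurs_wordTuple_filter h (F := u :: F) ?_, ?_⟩
    · intro x hx
      obtain ⟨v, hv, hvx⟩ := hF x hx
      exact ⟨v, List.mem_cons_of_mem _ hv, hvx⟩
    · rw [occursW_wordTuple, List.mem_filter]
      exact ⟨List.mem_cons_self, by simpa using hu⟩

end Points

/-! ## The enumerations for a product -/

section Checks

variable {A : Type} [Zero A] [One A] [DecidableEq A] (Φ : ℕ → ℕ → ℕ) (ok : ℕ → Prop)

/-- The word `w` is a tuple of words of an admissible length. -/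
def IsTuple (w : List A) : Prop := wordTuple (occ w) = w ∧ ok (occ w).length

/-- The component number `i` of a tuple of words. -/
def arg (w : List A) (i : ℕ) : List A := (occ w).getD i []

/-- From `l` it can be seen that `z` is listed in the first part of the name of the factor `i`. -/
def SeesDom (l : List A) (i : ℕ) (z : List A) : Prop := z ∈ occ (sel (fun j => Φ i (4 * j)) l)

/-- From `l` it can be seen that `z` is listed in the second part of the name of the factor `i`. -/
def SeesInter (l : List A) (i : ℕ) (z : List A) : Prop :=
  z ∈ occ (sel (fun j => Φ i (4 * j + 2)) l)

/-- The covers listed in the name of the factor `i`, as far as they can be seen from `l`. -/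
def seenCovers (l : List A) (i : ℕ) : List (List A) := occ (sel (fun j => Φ i (2 * j + 1)) l)

/-- From `l` it can be seen that the tuple `w` is in the domain. -/
def SeesMem (l w : List A) : Prop :=
  IsTuple ok w ∧ ∀ i < (occ w).length, SeesDom Φ l i (wordTuple [arg w i, [1]])

/-- From `l` it can be seen that the tuple `w` is not in the domain. -/
def SeesNotMem (l w : List A) : Prop :=
  ¬ IsTuple ok w ∨ ∃ i < (occ w).length, SeesDom Φ l i (wordTuple [arg w i, [0]])

/-- The enumeration of the graph of the characteristic function of the domain. -/
def EnumDom (z l : List A) : Prop :=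
  ∃ w ∈ occ z, (SeesMem Φ ok l w ∧ z = wordTuple [w, [1]]) ∨
    (SeesNotMem Φ ok l w ∧ z = wordTuple [w, [0]])

/-- The component `i` of the tuple `w` is a component of the intersection of the base elements
`u` and `v`. -/
def SeesInterAt (l u v w : List A) (i : ℕ) : Prop :=
  (i < (occ u).length ∧ i < (occ v).length ∧
    SeesInter Φ l i (wordTuple [arg u i, arg v i, arg w i])) ∨
  (i < (occ u).length ∧ (occ v).length ≤ i ∧ arg w i = arg u i ∧
    SeesDom Φ l i (wordTuple [arg u i, [1]])) ∨
  ((occ u).length ≤ i ∧ i < (occ v).length ∧ arg w i = arg v i ∧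
    SeesDom Φ l i (wordTuple [arg v i, [1]]))

/-- The enumeration of the intersections. -/
def EnumInter (z l : List A) : Prop :=
  ∃ u ∈ occ z, ∃ v ∈ occ z, ∃ w ∈ occ z, z = wordTuple [u, v, w] ∧
    IsTuple ok u ∧ IsTuple ok v ∧ IsTuple ok w ∧
    (occ w).length = max (occ u).length (occ v).length ∧
    ∀ i < (occ w).length, SeesInterAt Φ l u v w i

/-- The components of a tuple of words, with their positions. -/
def indexed (v : List A) : List (List A × ℕ) :=
  (List.range (occ v).length).map fun i => (arg v i, i)

/-- The enumeration of the minimal covers. -/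
def EnumCover (w l : List A) : Prop :=
  (∀ v ∈ occ w, IsTuple ok v ∧
    ∀ i < (occ v).length, ∃ w' ∈ seenCovers Φ l i, arg v i ∈ occ w') ∧
  ∀ c ∈ ((occ w).map indexed).sections, ∃ i < l.length, ∃ w' ∈ seenCovers Φ l i,
    ∀ u ∈ occ w', (u, i) ∈ c

end Checks

/-- The pair `Y` behaves like a product of the pairs `C i`: its base elements are named by the
tuples of words of admissible length. -/
structure IsProduct {A : Type} [Zero A] [One A] (C : ℕ → CompactPair.{u} A) (ok : ℕ → Prop)
    (Y : CompactPair.{u} A) (proj : Y.space.carrier → ∀ i, (C i).space.carrier) : Prop where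
  mem_dom_iff : ∀ w, w ∈ Y.space.ν.Dom ↔ ∃ us : List (List A), ok us.length ∧ w = wordTuple us ∧
    ∀ (i : ℕ) (h : i < us.length), us[i] ∈ (C i).space.ν.Dom
  inBase_iff : ∀ w y, InBase Y.space w y ↔ ∃ us : List (List A), ok us.length ∧
    w = wordTuple us ∧ ∀ (i : ℕ) (h : i < us.length), InBase (C i).space us[i] (proj y i)
  proj_mem : ∀ y ∈ Y.set, ∀ i, proj y i ∈ (C i).set
  exists_proj_eq : ∀ x : ∀ i, (C i).space.carrier, (∀ i, x i ∈ (C i).set) →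
    ∃ y ∈ Y.set, ∀ n, ok n → ∀ i < n, proj y i = x i
  nonempty : ∀ n, ok n → (∀ i < n, (C i).set.Nonempty) → ∀ i, (C i).set.Nonempty

namespace IsProduct

variable {A : Type} [Zero A] [One A] [NeZero (1 : A)] [DecidableEq A] {C : ℕ → CompactPair.{u} A}
  {ok : ℕ → Prop} {Y : CompactPair.{u} A} {proj : Y.space.carrier → ∀ i, (C i).space.carrier}

theorem exists_tuple_iff {P : ℕ → List A → Prop} {w : List A} :
    (∃ us : List (List A), ok us.length ∧ w = wordTuple us ∧
      ∀ (i : ℕ) (h : i < us.length), P i us[i]) ↔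
    IsTuple ok w ∧ ∀ i < (occ w).length, P i (arg w i) := by
  constructor
  · rintro ⟨us, hok, rfl, h⟩
    simp only [IsTuple, arg, occ_wordTuple, true_and]
    refine ⟨hok, fun i hi => ?_⟩
    rw [List.getD_eq_getElem _ _ hi]
    exact h i hi
  · rintro ⟨⟨e, hok⟩, h⟩
    refine ⟨occ w, hok, e.symm, fun i hi => ?_⟩
    have := h i hi
    rwa [arg, List.getD_eq_getElem _ _ hi] at this

variable (hY : IsProduct C ok Y proj)
include hY

theorem mem_dom_iff' (w : List A) : w ∈ Y.space.ν.Dom ↔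
    IsTuple ok w ∧ ∀ i < (occ w).length, arg w i ∈ (C i).space.ν.Dom := by
  rw [hY.mem_dom_iff, exists_tuple_iff (P := fun i u => u ∈ (C i).space.ν.Dom)]

theorem inBase_iff' (w : List A) (y) : InBase Y.space w y ↔
    IsTuple ok w ∧ ∀ i < (occ w).length, InBase (C i).space (arg w i) (proj y i) := by
  rw [hY.inBase_iff, exists_tuple_iff (P := fun i u => InBase (C i).space u (proj y i))]

theorem exists_mem_inBase_iff (v : List A) : (∃ y ∈ Y.set, InBase Y.space v y) ↔
    IsTuple ok v ∧
      ∀ i < (occ v).length, ∃ x ∈ (C i).set, InBase (C i).space (arg v i) x := by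
  constructor
  · rintro ⟨y, hy, h⟩
    rw [hY.inBase_iff'] at h
    exact ⟨h.1, fun i hi => ⟨proj y i, hY.proj_mem y hy i, h.2 i hi⟩⟩
  · rintro ⟨ht, h⟩
    have hne := hY.nonempty _ ht.2 fun i hi => by
      obtain ⟨x, hx, -⟩ := h i hi
      exact ⟨x, hx⟩
    have hex : ∀ i, ∃ x ∈ (C i).set,
        i < (occ v).length → InBase (C i).space (arg v i) x := by
      intro i
      by_cases hi : i < (occ v).length
      · obtain ⟨x, hx, hb⟩ := h i hi
        exact ⟨x, hx, fun _ => hb⟩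
      · obtain ⟨x, hx⟩ := hne i
        exact ⟨x, hx, fun h => absurd h hi⟩
    choose x hx hb using hex
    obtain ⟨y, hy, hyx⟩ := hY.exists_proj_eq x hx
    refine ⟨y, hy, (hY.inBase_iff' _ _).2 ⟨ht, fun i hi => ?_⟩⟩
    rw [hyx _ ht.2 i hi]
    exact hb i hi

/-- A product of sets is covered by finitely many boxes iff for every choice of one side of each
box, the chosen sides that belong to some factor cover that factor. -/
theorem cover_iff {F : List (List A)} (hF : ∀ v ∈ F, IsTuple ok v) :
    (∀ y ∈ Y.set, ∃ v ∈ F, InBase Y.space v y) ↔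
    ∀ c ∈ (F.map indexed).sections, ∃ i, ∀ x ∈ (C i).set, ∃ u, (u, i) ∈ c ∧
      InBase (C i).space u x := by
  constructor
  · intro h c hc
    by_contra! hne
    choose x hx hxc using hne
    obtain ⟨y, hy, hyx⟩ := hY.exists_proj_eq x hx
    obtain ⟨v, hv, hvy⟩ := h y hy
    rw [List.mem_sections] at hc
    obtain ⟨b, hb, hbv⟩ : ∃ b ∈ c, b ∈ indexed v := by
      obtain ⟨k, hk, rfl⟩ := List.getElem_of_mem hv
      have hlen := hc.length_eq
      rw [List.length_map] at hlen
      refine ⟨c.get ⟨k, by lia⟩, List.get_mem _ _, ?_⟩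
      have := hc.get (i := k) (by lia) (by simpa using hk)
      simpa using this
    rw [indexed, List.mem_map] at hbv
    obtain ⟨i, hi, rfl⟩ := hbv
    rw [List.mem_range] at hi
    refine hxc i _ hb ?_
    rw [← hyx _ (hF v hv).2 i hi]
    exact ((hY.inBase_iff' _ _).1 hvy).2 i hi
  · intro h y hy
    by_contra! hne
    have hex : ∀ v, ∃ b : List A × ℕ, v ∈ F → b ∈ indexed v ∧
        ¬ InBase (C b.2).space b.1 (proj y b.2) := by
      intro v
      by_cases hv : v ∈ F
      · have h1 := hne v hv
        rw [hY.inBase_iff'] at h1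
        push Not at h1
        obtain ⟨i, hi, hb⟩ := h1 (hF v hv)
        exact ⟨(arg v i, i), fun _ => ⟨List.mem_map.2 ⟨i, List.mem_range.2 hi, rfl⟩, hb⟩⟩
      · exact ⟨([], 0), fun h => absurd h hv⟩
    choose b hb using hex
    obtain ⟨i, hi⟩ := h (F.map b) (by
      rw [List.mem_sections, List.forall₂_map_left_iff, List.forall₂_map_right_iff,
        List.forall₂_same]
      exact fun v hv => (hb v hv).1)
    obtain ⟨u, hu, hin⟩ := hi _ (hY.proj_mem y hy i)
    obtain ⟨v, hv, hvu⟩ := List.mem_map.1 hu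
    have := (hb v hv).2
    rw [hvu] at this
    exact this hin

end IsProduct

end TTE

namespace TTE

open Filter

namespace IsProduct

variable {A : Type} [Zero A] [One A] [NeZero (1 : A)] [DecidableEq A] {C : ℕ → CompactPair.{u} A}
  {ok : ℕ → Prop} {Y : CompactPair.{u} A} {proj : Y.space.carrier → ∀ i, (C i).space.carrier}
  {Φ : ℕ → ℕ → ℕ} {p : ℕ → A}

section Sees

variable (hΦ : ∀ i, StrictMono (Φ i))
include hΦ

theorem strictMono_mul_add {i a b : ℕ} (ha : 0 < a) : StrictMono fun j => Φ i (a * j + b) := by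
  intro j k h
  have := Nat.mul_lt_mul_of_pos_left h ha
  exact hΦ i (by lia)

theorem occurs_of_seesDom {m i : ℕ} {z : List A} (h : SeesDom Φ (pre p m) i z) :
    Occurs z (comp 2 0 (comp 2 0 (p ∘ Φ i))) := by
  convert occurs_of_occursW_sel (strictMono_mul_add hΦ (b := 0) (by norm_num)) (mem_occ.1 h) using 1
  funext j
  simp only [comp, Function.comp_apply]
  congr 2
  lia

theorem eventually_seesDom {i : ℕ} {z : List A}
    (h : Occurs z (comp 2 0 (comp 2 0 (p ∘ Φ i)))) :
    ∀ᶠ m in atTop, SeesDom Φ (pre p m) i z := by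
  have e : comp 2 0 (comp 2 0 (p ∘ Φ i)) = p ∘ fun j => Φ i (4 * j) := by
    funext j
    simp only [comp, Function.comp_apply]
    congr 2
    lia
  rw [e] at h
  exact (eventually_occursW_sel (strictMono_mul_add hΦ (b := 0) (by norm_num)) h).mono
    fun m hm => mem_occ.2 hm

theorem occurs_of_seesInter {m i : ℕ} {z : List A} (h : SeesInter Φ (pre p m) i z) :
    Occurs z (comp 2 1 (comp 2 0 (p ∘ Φ i))) := by
  convert occurs_of_occursW_sel (strictMono_mul_add hΦ (by norm_num)) (mem_occ.1 h) using 1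
  funext j
  simp only [comp, Function.comp_apply]
  congr 2
  lia

theorem eventually_seesInter {i : ℕ} {z : List A}
    (h : Occurs z (comp 2 1 (comp 2 0 (p ∘ Φ i)))) :
    ∀ᶠ m in atTop, SeesInter Φ (pre p m) i z := by
  have e : comp 2 1 (comp 2 0 (p ∘ Φ i)) = p ∘ fun j => Φ i (4 * j + 2) := by
    funext j
    simp only [comp, Function.comp_apply]
    congr 2
    lia
  rw [e] at h
  exact (eventually_occursW_sel (strictMono_mul_add hΦ (by norm_num)) h).mono
    fun m hm => mem_occ.2 hm

theorem occurs_of_mem_seenCovers {m i : ℕ} {w : List A} (h : w ∈ seenCovers Φ (pre p m) i) :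
    Occurs w (comp 2 1 (p ∘ Φ i)) :=
  occurs_of_occursW_sel (strictMono_mul_add hΦ (by norm_num)) (mem_occ.1 h)

theorem eventually_mem_seenCovers {i : ℕ} {w : List A} (h : Occurs w (comp 2 1 (p ∘ Φ i))) :
    ∀ᶠ m in atTop, w ∈ seenCovers Φ (pre p m) i :=
  (eventually_occursW_sel (strictMono_mul_add hΦ (by norm_num)) h).mono fun _ hm => mem_occ.2 hm

end Sees

theorem eventually_forall_mem_list {B : Type*} {P : B → ℕ → Prop} {L : List B}
    (h : ∀ a ∈ L, ∀ᶠ m in atTop, P a m) : ∀ᶠ m in atTop, ∀ a ∈ L, P a m :=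
  (eventually_all_finite L.finite_toSet).2 h

theorem eventually_forall_lt {P : ℕ → ℕ → Prop} {n : ℕ}
    (h : ∀ i < n, ∀ᶠ m in atTop, P i m) : ∀ᶠ m in atTop, ∀ i < n, P i m :=
  (eventually_all_finite (Set.finite_Iio n)).2 h

variable (hY : IsProduct C ok Y proj) (hΦ : ∀ i, StrictMono (Φ i))
  (hp : ∀ i, C i ∈ kappaTildeDelta (p ∘ Φ i))
include hY hΦ hp

theorem mem_dom_of_seesMem {m : ℕ} {w : List A} (h : SeesMem Φ ok (pre p m) w) :
    w ∈ Y.space.ν.Dom :=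
  (hY.mem_dom_iff' w).2 ⟨h.1, fun i hi =>
    (occurs_dom_one (hp i).1 _).1 (occurs_of_seesDom hΦ (h.2 i hi))⟩

theorem eventually_seesMem {w : List A} (h : w ∈ Y.space.ν.Dom) :
    ∀ᶠ m in atTop, SeesMem Φ ok (pre p m) w := by
  obtain ⟨h1, h2⟩ := (hY.mem_dom_iff' w).1 h
  exact (eventually_forall_lt fun i hi => eventually_seesDom hΦ
    ((occurs_dom_one (hp i).1 _).2 (h2 i hi))).mono fun m hm => ⟨h1, hm⟩

theorem not_mem_dom_of_seesNotMem {m : ℕ} {w : List A} (h : SeesNotMem Φ ok (pre p m) w) :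
    w ∉ Y.space.ν.Dom := by
  intro hw
  obtain ⟨h1, h2⟩ := (hY.mem_dom_iff' w).1 hw
  rcases h with h | ⟨i, hi, h⟩
  · exact h h1
  · exact (occurs_dom_zero (hp i).1 _).1 (occurs_of_seesDom hΦ h) (h2 i hi)

theorem eventually_seesNotMem {w : List A} (h : w ∉ Y.space.ν.Dom) :
    ∀ᶠ m in atTop, SeesNotMem Φ ok (pre p m) w := by
  rw [hY.mem_dom_iff'] at h
  by_cases h1 : IsTuple ok w
  · push Not at h
    obtain ⟨i, hi, h2⟩ := h h1
    exact (eventually_seesDom hΦ ((occurs_dom_zero (hp i).1 _).2 h2)).mono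
      fun m hm => Or.inr ⟨i, hi, hm⟩
  · exact Eventually.of_forall fun m => Or.inl h1

theorem occurs_enumDom [Encodable A] : ∀ z : List A,
    Occurs z (enumSeq (EnumDom Φ ok) p) ↔ ∃ w, (w ∈ Y.space.ν.Dom ∧ z = wordTuple [w, [1]]) ∨
      (w ∉ Y.space.ν.Dom ∧ z = wordTuple [w, [0]]) := by
  refine occurs_enumSeq ?_ ?_
  · rintro z m ⟨w, -, ⟨h, rfl⟩ | ⟨h, rfl⟩⟩
    · exact ⟨w, Or.inl ⟨hY.mem_dom_of_seesMem hΦ hp h, rfl⟩⟩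
    · exact ⟨w, Or.inr ⟨hY.not_mem_dom_of_seesNotMem hΦ hp h, rfl⟩⟩
  · rintro z ⟨w, ⟨h, rfl⟩ | ⟨h, rfl⟩⟩
    · exact (hY.eventually_seesMem hΦ hp h).mono fun m hm =>
        ⟨w, by simp [occ_wordTuple], Or.inl ⟨hm, rfl⟩⟩
    · exact (hY.eventually_seesNotMem hΦ hp h).mono fun m hm =>
        ⟨w, by simp [occ_wordTuple], Or.inr ⟨hm, rfl⟩⟩

theorem occurs_enumCover [Encodable A] (w : List A) :
    Occurs w (enumSeq (EnumCover Φ ok) p) ↔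
      (∀ v, OccursW v w → ∃ y ∈ Y.set, InBase Y.space v y) ∧
        ∀ y ∈ Y.set, ∃ v, OccursW v w ∧ InBase Y.space v y := by
  have meets := fun i => exists_occurs_mem_iff (hp i).2 (C i).isCompact
  have covers := fun i => exists_occurs_subset_iff (hp i).2
  have sub : ∀ (c : List (List A × ℕ)) (i : ℕ) (u : List A),
      u ∈ ((c.filter fun b => b.2 = i).map Prod.fst) ↔ (u, i) ∈ c := by
    intro c i u
    simp only [List.mem_map, List.mem_filter, decide_eq_true_eq, Prod.exists, exists_and_right,
      exists_eq_right]
  simp only [← mem_occ, hY.exists_mem_inBase_iff]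
  refine occurs_enumSeq (P := fun w => (∀ v ∈ occ w, IsTuple ok v ∧ ∀ i < (occ v).length,
    ∃ x ∈ (C i).set, InBase (C i).space (arg v i) x) ∧
      ∀ y ∈ Y.set, ∃ v ∈ occ w, InBase Y.space v y) ?_ ?_ w
  · rintro w m ⟨h1, h2⟩
    refine ⟨fun v hv => ⟨(h1 v hv).1, fun i hi => ?_⟩,
      (hY.cover_iff fun v hv => (h1 v hv).1).2 fun c hc => ?_⟩
    · obtain ⟨w', hw', hu⟩ := (h1 v hv).2 i hi
      exact (meets i _).1 ⟨w', occurs_of_mem_seenCovers hΦ hw', mem_occ.1 hu⟩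
    · obtain ⟨i, -, w', hw', hu⟩ := h2 c hc
      refine ⟨i, fun x hx => ?_⟩
      obtain ⟨u, huc, hux⟩ := (covers i ((c.filter fun b => b.2 = i).map Prod.fst)).1
        ⟨w', occurs_of_mem_seenCovers hΦ hw',
          fun v hv => (sub c i v).2 (hu v (mem_occ.2 hv))⟩ x hx
      exact ⟨u, (sub c i u).1 huc, hux⟩
  · rintro w ⟨h1, h2⟩
    rw [hY.cover_iff fun v hv => (h1 v hv).1] at h2
    refine Eventually.and ?_ ?_
    · refine eventually_forall_mem_list fun v hv => ?_
      refine (eventually_forall_lt fun i hi => ?_).mono fun m hm => ⟨(h1 v hv).1, hm⟩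
      obtain ⟨w', hw', hu⟩ := (meets i _).2 ((h1 v hv).2 i hi)
      exact (eventually_mem_seenCovers hΦ hw').mono fun m hm => ⟨w', hm, mem_occ.2 hu⟩
    · refine eventually_forall_mem_list fun c hc => ?_
      obtain ⟨i, hi⟩ := h2 c hc
      obtain ⟨w', hw', hu⟩ := (covers i ((c.filter fun b => b.2 = i).map Prod.fst)).2
        fun x hx => by
          obtain ⟨u, huc, hux⟩ := hi x hx
          exact ⟨u, (sub c i u).2 huc, hux⟩
      filter_upwards [eventually_mem_seenCovers hΦ hw', eventually_gt_atTop i] with m hm hmi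
      exact ⟨i, by simpa using hmi, w', hm, fun u h => (sub c i u).1 (hu u (mem_occ.1 h))⟩

theorem exists_inter [Encodable A] : ∃ S : Set (List A × List A × List A),
    (∀ u v w, (u, v, w) ∈ S → u ∈ Y.space.ν.Dom ∧ v ∈ Y.space.ν.Dom ∧ w ∈ Y.space.ν.Dom) ∧
    (∀ z, Occurs z (enumSeq (EnumInter Φ ok) p) ↔
      ∃ u v w, (u, v, w) ∈ S ∧ z = wordTuple [u, v, w]) ∧
    ∀ u v, u ∈ Y.space.ν.Dom → v ∈ Y.space.ν.Dom → ∀ x,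
      InBase Y.space u x ∧ InBase Y.space v x ↔ ∃ w, (u, v, w) ∈ S ∧ InBase Y.space w x := by
  choose T hT1 hT2 hT3 using fun i => (mem_Delta_iff.1 (hp i).1).2
  have occT : ∀ i u v w, Occurs (wordTuple [u, v, w]) (comp 2 1 (comp 2 0 (p ∘ Φ i))) ↔
      (u, v, w) ∈ T i := by
    intro i u v w
    rw [hT2]
    constructor
    · rintro ⟨u', v', w', h, e⟩
      have := wordTuple_injective e
      simp only [List.cons.injEq, and_true] at this
      obtain ⟨rfl, rfl, rfl⟩ := this
      exact h
    · exact fun h => ⟨u, v, w, h, rfl⟩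
  let Q : List A → List A → List A → ℕ → Prop := fun u v w i =>
    (i < (occ u).length ∧ i < (occ v).length ∧ (arg u i, arg v i, arg w i) ∈ T i) ∨
    (i < (occ u).length ∧ (occ v).length ≤ i ∧ arg w i = arg u i ∧
      arg u i ∈ (C i).space.ν.Dom) ∨
    ((occ u).length ≤ i ∧ i < (occ v).length ∧ arg w i = arg v i ∧
      arg v i ∈ (C i).space.ν.Dom)
  let S : Set (List A × List A × List A) := {t | IsTuple ok t.1 ∧ IsTuple ok t.2.1 ∧
    IsTuple ok t.2.2 ∧ (occ t.2.2).length = max (occ t.1).length (occ t.2.1).length ∧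
    ∀ i < (occ t.2.2).length, Q t.1 t.2.1 t.2.2 i}
  refine ⟨S, ?_, ?_, ?_⟩
  · rintro u v w ⟨hu, hv, hw, hlen, h⟩
    simp only [hY.mem_dom_iff']
    refine ⟨⟨hu, fun i hi => ?_⟩, ⟨hv, fun i hi => ?_⟩, hw, fun i hi => ?_⟩
    · rcases h i (by simp only at hlen ⊢; lia) with h | h | h
      · exact (hT1 _ _ _ _ h.2.2).1
      · exact h.2.2.2
      · exact absurd hi (not_lt.2 h.1)
    · rcases h i (by simp only at hlen ⊢; lia) with h | h | h
      · exact (hT1 _ _ _ _ h.2.2).2.1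
      · exact absurd hi (not_lt.2 h.2.1)
      · exact h.2.2.2
    · rcases h i hi with h | h | h
      · exact (hT1 _ _ _ _ h.2.2).2.2
      · exact h.2.2.1 ▸ h.2.2.2
      · exact h.2.2.1 ▸ h.2.2.2
  · refine occurs_enumSeq ?_ ?_
    · rintro z m ⟨u, -, v, -, w, -, rfl, hu, hv, hw, hlen, h⟩
      refine ⟨u, v, w, ⟨hu, hv, hw, hlen, fun i hi => ?_⟩, rfl⟩
      rcases h i hi with ⟨h1, h2, h3⟩ | ⟨h1, h2, h3, h4⟩ | ⟨h1, h2, h3, h4⟩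
      · exact Or.inl ⟨h1, h2, (occT _ _ _ _).1 (occurs_of_seesInter hΦ h3)⟩
      · exact Or.inr (Or.inl ⟨h1, h2, h3,
          (occurs_dom_one (hp i).1 _).1 (occurs_of_seesDom hΦ h4)⟩)
      · exact Or.inr (Or.inr ⟨h1, h2, h3,
          (occurs_dom_one (hp i).1 _).1 (occurs_of_seesDom hΦ h4)⟩)
    · rintro z ⟨u, v, w, ⟨hu, hv, hw, hlen, h⟩, rfl⟩
      have key : ∀ᶠ m in atTop, ∀ i < (occ w).length, SeesInterAt Φ (pre p m) u v w i := by
        refine eventually_forall_lt fun i hi => ?_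
        rcases h i hi with ⟨h1, h2, h3⟩ | ⟨h1, h2, h3, h4⟩ | ⟨h1, h2, h3, h4⟩
        · exact (eventually_seesInter hΦ ((occT _ _ _ _).2 h3)).mono
            fun m hm => Or.inl ⟨h1, h2, hm⟩
        · exact (eventually_seesDom hΦ ((occurs_dom_one (hp i).1 _).2 h4)).mono
            fun m hm => Or.inr (Or.inl ⟨h1, h2, h3, hm⟩)
        · exact (eventually_seesDom hΦ ((occurs_dom_one (hp i).1 _).2 h4)).mono
            fun m hm => Or.inr (Or.inr ⟨h1, h2, h3, hm⟩)
      exact key.mono fun m hm => ⟨u, by simp [occ_wordTuple], v, by simp [occ_wordTuple], w,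
        by simp [occ_wordTuple], rfl, hu, hv, hw, hlen, hm⟩
  · intro u v hu hv y
    obtain ⟨tu, du⟩ := (hY.mem_dom_iff' u).1 hu
    obtain ⟨tv, dv⟩ := (hY.mem_dom_iff' v).1 hv
    simp only [hY.inBase_iff']
    constructor
    · rintro ⟨⟨-, bu⟩, -, bv⟩
      have hex : ∀ i, ∃ w, i < max (occ u).length (occ v).length →
          InBase (C i).space w (proj y i) ∧
          ((i < (occ u).length ∧ i < (occ v).length ∧ (arg u i, arg v i, w) ∈ T i) ∨
          (i < (occ u).length ∧ (occ v).length ≤ i ∧ w = arg u i ∧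
            arg u i ∈ (C i).space.ν.Dom) ∨
          ((occ u).length ≤ i ∧ i < (occ v).length ∧ w = arg v i ∧
            arg v i ∈ (C i).space.ν.Dom)) := by
        intro i
        by_cases h1 : i < (occ u).length
        · by_cases h2 : i < (occ v).length
          · obtain ⟨w, hw, hb⟩ := (hT3 i _ _ (du i h1) (dv i h2) _).1 ⟨bu i h1, bv i h2⟩
            exact ⟨w, fun _ => ⟨hb, Or.inl ⟨h1, h2, hw⟩⟩⟩
          · exact ⟨arg u i, fun _ => ⟨bu i h1, Or.inr (Or.inl ⟨h1, not_lt.1 h2, rfl, du i h1⟩)⟩⟩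
        · by_cases h2 : i < (occ v).length
          · exact ⟨arg v i, fun _ => ⟨bv i h2, Or.inr (Or.inr ⟨not_lt.1 h1, h2, rfl, dv i h2⟩)⟩⟩
          · exact ⟨[], fun h => by lia⟩
      choose g hg using hex
      let ws : List (List A) := (List.range (max (occ u).length (occ v).length)).map g
      have hlen : ws.length = max (occ u).length (occ v).length := by simp [ws]
      have harg : ∀ i < max (occ u).length (occ v).length, arg (wordTuple ws) i = g i := by
        intro i hi
        rw [arg, occ_wordTuple, List.getD_eq_getElem _ _ (by lia)]
        simp [ws]
      have tw : IsTuple ok (wordTuple ws) := by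
        refine ⟨by rw [occ_wordTuple], ?_⟩
        rw [occ_wordTuple, hlen]
        rcases max_choice (occ u).length (occ v).length with h | h
        · rw [h]
          exact tu.2
        · rw [h]
          exact tv.2
      refine ⟨wordTuple ws, ⟨tu, tv, tw, by rw [occ_wordTuple, hlen], fun i hi => ?_⟩, tw,
        fun i hi => ?_⟩
      · rw [occ_wordTuple, hlen] at hi
        simp only [Q, harg i hi]
        exact (hg i hi).2
      · rw [occ_wordTuple, hlen] at hi
        rw [harg i hi]
        exact (hg i hi).1
    · rintro ⟨w, ⟨-, -, -, hlen, h⟩, -, bw⟩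
      simp only at hlen h
      refine ⟨⟨tu, fun i hi => ?_⟩, tv, fun i hi => ?_⟩
      · have hi' : i < (occ w).length := by lia
        rcases h i hi' with ⟨h1, h2, h3⟩ | ⟨h1, h2, h3, h4⟩ | ⟨h1, h2, h3, h4⟩
        · exact ((hT3 i _ _ (du i h1) (dv i h2) _).2 ⟨_, h3, bw i hi'⟩).1
        · exact h3 ▸ bw i hi'
        · exact absurd hi (not_lt.2 h1)
      · have hi' : i < (occ w).length := by lia
        rcases h i hi' with ⟨h1, h2, h3⟩ | ⟨h1, h2, h3, h4⟩ | ⟨h1, h2, h3, h4⟩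
        · exact ((hT3 i _ _ (du i h1) (dv i h2) _).2 ⟨_, h3, bw i hi'⟩).2
        · exact absurd hi (not_lt.2 h2)
        · exact h3 ▸ bw i hi'

end IsProduct

section Output

variable {A : Type} [Zero A] [One A] [DecidableEq A] [Encodable A]

/-- The name of a product. -/
noncomputable def prodName (Φ : ℕ → ℕ → ℕ) (ok : ℕ → Prop) (p : ℕ → A) : ℕ → A := fun n =>
  if n % 2 = 1 then enumSeq (EnumCover Φ ok) p (n / 2)
  else if n % 4 = 0 then enumSeq (EnumDom Φ ok) p (n / 4)
  else enumSeq (EnumInter Φ ok) p (n / 4)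

/-- The symbol number `n` of the name of a product, computed from a prefix of the input. -/
noncomputable def prodSym (Φ : ℕ → ℕ → ℕ) (ok : ℕ → Prop) (l : List A) (n : ℕ) : A :=
  if n % 2 = 1 then enumSym (EnumCover Φ ok) l (n / 2)
  else if n % 4 = 0 then enumSym (EnumDom Φ ok) l (n / 4)
  else enumSym (EnumInter Φ ok) l (n / 4)

theorem prodSym_pre {Φ : ℕ → ℕ → ℕ} {ok : ℕ → Prop} (p : ℕ → A) {n N : ℕ} (h : n ≤ N) :
    prodSym Φ ok (pre p N) n = prodName Φ ok p n := by
  rw [prodSym, prodName, enumSym_pre _ _ (by lia), enumSym_pre _ _ (by lia),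
    enumSym_pre _ _ (by lia)]

theorem IsProduct.mem_prodName [NeZero (1 : A)] {C : ℕ → CompactPair.{u} A} {ok : ℕ → Prop}
    {Y : CompactPair.{u} A} {proj : Y.space.carrier → ∀ i, (C i).space.carrier}
    (hY : IsProduct C ok Y proj) {Φ : ℕ → ℕ → ℕ} (hΦ : ∀ i, StrictMono (Φ i)) {p : ℕ → A}
    (hp : ∀ i, C i ∈ kappaTildeDelta (p ∘ Φ i)) : Y ∈ kappaTildeDelta (prodName Φ ok p) := by
  have h1 : comp 2 0 (comp 2 0 (prodName Φ ok p)) = enumSeq (EnumDom Φ ok) p := by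
    funext j
    simp only [comp, prodName]
    rw [if_neg (by lia), if_pos (by lia)]
    congr 1
    lia
  have h2 : comp 2 1 (comp 2 0 (prodName Φ ok p)) = enumSeq (EnumInter Φ ok) p := by
    funext j
    simp only [comp, prodName]
    rw [if_neg (by lia), if_neg (by lia)]
    congr 1
    lia
  have h3 : comp 2 1 (prodName Φ ok p) = enumSeq (EnumCover Φ ok) p := by
    funext j
    simp only [comp, prodName]
    rw [if_pos (by lia)]
    congr 1
    lia
  refine ⟨mem_Delta_iff.2 ⟨?_, ?_⟩, mem_kappaTilde_iff.2 ?_⟩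
  · rw [h1]
    exact hY.occurs_enumDom hΦ hp
  · rw [h2]
    exact hY.exists_inter hΦ hp
  · rw [h3]
    exact hY.occurs_enumCover hΦ hp

end Output

end TTE

namespace TTE

open Encodable

/-! ## Primitive recursiveness of the enumerations -/

section Quantifiers

variable {α β : Type*} [Primcodable α] [Primcodable β] {P : α → β → Prop} {f : α → List β}

theorem primrecPred_exists_mem (hf : Primrec f) (hP : PrimrecRel P) :
    PrimrecPred fun a => ∃ b ∈ f a, P a b :=
  hP.swap.exists_mem_list.comp hf Primrec.id

theorem primrecPred_forall_mem (hf : Primrec f) (hP : PrimrecRel P) :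
    PrimrecPred fun a => ∀ b ∈ f a, P a b :=
  hP.swap.forall_mem_list.comp hf Primrec.id

variable {Q : α → ℕ → Prop} {g : α → ℕ}

theorem primrecPred_exists_lt (hg : Primrec g) (hQ : PrimrecRel Q) :
    PrimrecPred fun a => ∃ i < g a, Q a i :=
  (primrecPred_exists_mem (Primrec.list_range.comp hg) hQ).of_eq fun a => by simp

theorem primrecPred_forall_lt (hg : Primrec g) (hQ : PrimrecRel Q) :
    PrimrecPred fun a => ∀ i < g a, Q a i :=
  (primrecPred_forall_mem (Primrec.list_range.comp hg) hQ).of_eq fun a => by simp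

theorem primrecRel_mem : PrimrecRel fun (b : β) (l : List β) => b ∈ l :=
  (primrecPred_exists_mem (f := Prod.snd) (P := fun (x : β × List β) b => b = x.1) Primrec.snd
    (Primrec.eq.comp Primrec.snd (Primrec.fst.comp Primrec.fst))).of_eq fun x => by simp

theorem primrec_sections : Primrec (List.sections : List (List β) → List (List β)) := by
  have h : Primrec fun L : List (List β) =>
      L.foldr (fun l acc => acc.flatMap fun s => l.map fun a => a :: s) [[]] := by
    have hs : Primrec₂ fun (_ : List (List β)) (x : List β × List (List β)) =>
        x.2.flatMap fun s => x.1.map fun a => a :: s := by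
      refine Primrec.list_flatMap (Primrec.snd.comp Primrec.snd) ?_
      refine Primrec.list_map (Primrec.fst.comp (Primrec.snd.comp Primrec.fst)) ?_
      exact Primrec.list_cons.comp Primrec.snd (Primrec.snd.comp Primrec.fst)
    exact Primrec.list_foldr Primrec.id (Primrec.const _) hs
  refine h.of_eq fun L => ?_
  induction L with
  | nil => rfl
  | cons l L ih => rw [List.foldr_cons, ih, List.sections]

end Quantifiers

section Words

variable {A : Type} [Primcodable A] [Zero A] [One A]

theorem primrec_iota : Primrec (iota : List A → List A) :=
  Primrec.list_append.comp (Primrec.list_append.comp (Primrec.const _)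
    (Primrec.list_flatMap Primrec.id
      (Primrec.list_cons.comp Primrec.snd (Primrec.const [0])))) (Primrec.const _)

theorem primrec_wordTuple : Primrec (wordTuple : List (List A) → List A) :=
  Primrec.list_flatMap Primrec.id (primrec_iota.comp Primrec.snd)

theorem primrec_wordTuple_pair {α : Type*} [Primcodable α] {f g : α → List A}
    (hf : Primrec f) (hg : Primrec g) :
    Primrec fun a => wordTuple [f a, g a] :=
  primrec_wordTuple.comp (Primrec.list_cons.comp hf (Primrec.list_cons.comp hg (Primrec.const [])))

theorem primrec_wordTuple_triple {α : Type*} [Primcodable α] {f g h : α → List A}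
    (hf : Primrec f) (hg : Primrec g) (hh : Primrec h) : Primrec fun a => wordTuple [f a, g a, h a] :=
  primrec_wordTuple.comp (Primrec.list_cons.comp hf
    (Primrec.list_cons.comp hg (Primrec.list_cons.comp hh (Primrec.const []))))

theorem primrec_block : Primrec (block : Option (List A) → List A) :=
  (Primrec.option_casesOn Primrec.id (Primrec.const [1])
    (primrec_iota.comp₂ Primrec₂.right)).of_eq
    fun o => by cases o <;> rfl

theorem primrec_enumSym {R : List A → List A → Prop} (hR : PrimrecRel R) :
    Primrec₂ (enumSym R) := by
  classical
  have hstage : Primrec₂ (stage R) := by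
    refine Primrec.option_bind (Primrec.decode.comp
      (Primrec.fst.comp (Primrec.unpair.comp Primrec.snd))) ?_
    refine Primrec.ite (hR.comp Primrec.snd (Primrec.list_take.comp
      (Primrec.snd.comp Primrec.fst) (Primrec.fst.comp Primrec.fst))) ?_ (Primrec.const none)
    exact Primrec.option_some.comp Primrec.snd
  refine (Primrec.list_getD 1).comp (Primrec.list_flatMap (Primrec.list_range.comp
    (Primrec.succ.comp Primrec.snd)) ?_) Primrec.snd
  exact primrec_block.comp (hstage.comp (Primrec.fst.comp Primrec.fst) Primrec.snd)

variable [DecidableEq A]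

theorem primrec_parseHead : Primrec (parseHead : List A → List (List A)) := by
  have hrel : PrimrecRel fun v x : List A => iota v = x.take (iota v).length :=
    Primrec.eq.comp (primrec_iota.comp Primrec.fst)
      (Primrec.list_take.comp (Primrec.list_length.comp (primrec_iota.comp Primrec.fst))
        Primrec.snd)
  have hcand : Primrec fun x : List A => (List.range (x.length + 1)).map fun k =>
      (List.range k).map fun t => x.getD (3 + 2 * t) 0 := by
    refine Primrec.list_map (Primrec.list_range.comp (Primrec.succ.comp Primrec.list_length)) ?_
    refine Primrec.list_map (Primrec.list_range.comp Primrec.snd) ?_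
    exact (Primrec.list_getD 0).comp (Primrec.fst.comp Primrec.fst)
      (Primrec.nat_add.comp (Primrec.const 3) (Primrec.nat_mul.comp (Primrec.const 2) Primrec.snd))
  exact Primrec.optionToList.comp
    (Primrec.list_head?.comp (hrel.listFilter.comp hcand Primrec.id))

theorem primrec_occ : Primrec (occ : List A → List (List A)) := by
  have h : Primrec fun w : List A =>
      (List.range (w.length + 1)).flatMap fun i => parseHead (w.drop i) :=
    Primrec.list_flatMap (Primrec.list_range.comp (Primrec.succ.comp Primrec.list_length))
      (primrec_parseHead.comp (Primrec.list_drop.comp Primrec.snd Primrec.fst))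
  refine h.of_eq fun w => ?_
  induction w with
  | nil => simp [occ]
  | cons a w ih =>
    rw [occ_cons, ← ih, List.length_cons, List.range_succ_eq_map, List.flatMap_cons,
      List.flatMap_map]
    rfl

theorem primrec_length_occ : Primrec fun w : List A => (occ w).length :=
  Primrec.list_length.comp primrec_occ

theorem primrec_arg : Primrec₂ (arg : List A → ℕ → List A) :=
  (Primrec.list_getD []).comp (primrec_occ.comp Primrec.fst) Primrec.snd

theorem primrec_indexed : Primrec (indexed : List A → List (List A × ℕ)) :=
  Primrec.list_map (Primrec.list_range.comp primrec_length_occ)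
    (Primrec.pair primrec_arg Primrec.snd)

theorem primrecPred_isTuple {ok : ℕ → Prop} (hok : PrimrecPred ok) :
    PrimrecPred (IsTuple (A := A) ok) :=
  (Primrec.eq.comp (primrec_wordTuple.comp primrec_occ) Primrec.id).and
    (hok.comp primrec_length_occ)

end Words

section Checks

theorem primrec_sel {A : Type} [Primcodable A] {Φ : ℕ → ℕ → ℕ} (hΦ : Primrec₂ Φ) (a b : ℕ) :
    Primrec₂ fun (l : List A) (i : ℕ) => sel (fun j => Φ i (a * j + b)) l := by
  refine Primrec.listFilterMap (Primrec.list_range.comp (Primrec.list_length.comp Primrec.fst)) ?_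
  refine Primrec.list_getElem?.comp (Primrec.fst.comp Primrec.fst) ?_
  exact hΦ.comp (Primrec.snd.comp Primrec.fst) (Primrec.nat_add.comp
    (Primrec.nat_mul.comp (Primrec.const a) Primrec.snd) (Primrec.const b))

variable {A : Type} [Primcodable A] [Zero A] [One A] [DecidableEq A]
  {Φ : ℕ → ℕ → ℕ} {ok : ℕ → Prop} (hΦ : Primrec₂ Φ) (hok : PrimrecPred ok)
  {α : Type*} [Primcodable α]

section

include hΦ

theorem primrecPred_seesDom {l z : α → List A} {i : α → ℕ} (hl : Primrec l) (hi : Primrec i)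
    (hz : Primrec z) : PrimrecPred fun a => SeesDom Φ (l a) (i a) (z a) :=
  primrecRel_mem.comp hz (primrec_occ.comp ((primrec_sel hΦ 4 0).comp hl hi))

theorem primrecPred_seesInter {l z : α → List A} {i : α → ℕ} (hl : Primrec l) (hi : Primrec i)
    (hz : Primrec z) : PrimrecPred fun a => SeesInter Φ (l a) (i a) (z a) :=
  primrecRel_mem.comp hz (primrec_occ.comp ((primrec_sel hΦ 4 2).comp hl hi))

theorem primrec_seenCovers {l : α → List A} {i : α → ℕ} (hl : Primrec l) (hi : Primrec i) :
    Primrec fun a => seenCovers Φ (l a) (i a) :=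
  primrec_occ.comp ((primrec_sel hΦ 2 1).comp hl hi)

include hok

theorem primrecRel_seesMem : PrimrecRel (SeesMem (A := A) Φ ok) := by
  refine PrimrecPred.and ((primrecPred_isTuple hok).comp Primrec.snd)
    (primrecPred_forall_lt (primrec_length_occ.comp Primrec.snd) ?_)
  exact primrecPred_seesDom hΦ (Primrec.fst.comp Primrec.fst) Primrec.snd
    (primrec_wordTuple_pair (primrec_arg.comp (Primrec.snd.comp Primrec.fst) Primrec.snd)
      (Primrec.const _))

theorem primrecRel_seesNotMem : PrimrecRel (SeesNotMem (A := A) Φ ok) := by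
  refine PrimrecPred.or ((primrecPred_isTuple hok).comp Primrec.snd).not
    (primrecPred_exists_lt (primrec_length_occ.comp Primrec.snd) ?_)
  exact primrecPred_seesDom hΦ (Primrec.fst.comp Primrec.fst) Primrec.snd
    (primrec_wordTuple_pair (primrec_arg.comp (Primrec.snd.comp Primrec.fst) Primrec.snd)
      (Primrec.const _))

theorem primrecRel_enumDom : PrimrecRel (EnumDom (A := A) Φ ok) := by
  refine primrecPred_exists_mem (primrec_occ.comp Primrec.fst) (PrimrecPred.or ?_ ?_)
  · refine PrimrecPred.and ((primrecRel_seesMem hΦ hok).comp (Primrec.snd.comp Primrec.fst)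
      Primrec.snd) ?_
    exact Primrec.eq.comp (Primrec.fst.comp Primrec.fst)
      (primrec_wordTuple_pair Primrec.snd (Primrec.const _))
  · refine PrimrecPred.and ((primrecRel_seesNotMem hΦ hok).comp (Primrec.snd.comp Primrec.fst)
      Primrec.snd) ?_
    exact Primrec.eq.comp (Primrec.fst.comp Primrec.fst)
      (primrec_wordTuple_pair Primrec.snd (Primrec.const _))

theorem primrecRel_enumCover : PrimrecRel (EnumCover (A := A) Φ ok) := by
  refine PrimrecPred.and (primrecPred_forall_mem (primrec_occ.comp Primrec.fst)
    (PrimrecPred.and ((primrecPred_isTuple hok).comp Primrec.snd)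
      (primrecPred_forall_lt (primrec_length_occ.comp Primrec.snd)
        (primrecPred_exists_mem ?_ ?_))))
    (primrecPred_forall_mem (primrec_sections.comp
      (Primrec.list_map (primrec_occ.comp Primrec.fst) (primrec_indexed.comp Primrec.snd)))
      (primrecPred_exists_lt (Primrec.list_length.comp (Primrec.snd.comp Primrec.fst))
        (primrecPred_exists_mem ?_ (primrecPred_forall_mem (primrec_occ.comp Primrec.snd) ?_))))
  · exact primrec_seenCovers hΦ (Primrec.snd.comp (Primrec.fst.comp Primrec.fst)) Primrec.snd
  · exact primrecRel_mem.comp (primrec_arg.comp (Primrec.snd.comp (Primrec.fst.comp Primrec.fst))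
      (Primrec.snd.comp Primrec.fst)) (primrec_occ.comp Primrec.snd)
  · exact primrec_seenCovers hΦ (Primrec.snd.comp (Primrec.fst.comp Primrec.fst)) Primrec.snd
  · exact primrecRel_mem.comp
      (Primrec.pair Primrec.snd (Primrec.snd.comp (Primrec.fst.comp Primrec.fst)))
      (Primrec.snd.comp (Primrec.fst.comp (Primrec.fst.comp Primrec.fst)))

end

section

include hΦ

theorem primrecPred_seesInterAt {l u v w : α → List A} {i : α → ℕ} (hl : Primrec l)
    (hu : Primrec u) (hv : Primrec v) (hw : Primrec w) (hi : Primrec i) :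
    PrimrecPred fun a => SeesInterAt Φ (l a) (u a) (v a) (w a) (i a) := by
  have lu := primrec_length_occ.comp hu
  have lv := primrec_length_occ.comp hv
  have au := primrec_arg.comp hu hi
  have av := primrec_arg.comp hv hi
  have aw := primrec_arg.comp hw hi
  refine PrimrecPred.or ?_ (PrimrecPred.or ?_ ?_)
  · exact (Primrec.nat_lt.comp hi lu).and ((Primrec.nat_lt.comp hi lv).and
      (primrecPred_seesInter hΦ hl hi (primrec_wordTuple_triple au av aw)))
  · exact (Primrec.nat_lt.comp hi lu).and ((Primrec.nat_le.comp lv hi).and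
      ((Primrec.eq.comp aw au).and
        (primrecPred_seesDom hΦ hl hi (primrec_wordTuple_pair au (Primrec.const _)))))
  · exact (Primrec.nat_le.comp lu hi).and ((Primrec.nat_lt.comp hi lv).and
      ((Primrec.eq.comp aw av).and
        (primrecPred_seesDom hΦ hl hi (primrec_wordTuple_pair av (Primrec.const _)))))

include hok

theorem primrecRel_enumInter : PrimrecRel (EnumInter (A := A) Φ ok) := by
  have z : Primrec fun x : ((List A × List A) × List A) × List A => x.1.1.1 :=
    Primrec.fst.comp (Primrec.fst.comp Primrec.fst)
  have u : Primrec fun x : (((List A × List A) × List A) × List A) × List A => x.1.1.2 :=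
    Primrec.snd.comp (Primrec.fst.comp Primrec.fst)
  have v : Primrec fun x : (((List A × List A) × List A) × List A) × List A => x.1.2 :=
    Primrec.snd.comp Primrec.fst
  have w : Primrec fun x : (((List A × List A) × List A) × List A) × List A => x.2 := Primrec.snd
  have t := primrecPred_isTuple (A := A) hok
  refine primrecPred_exists_mem (primrec_occ.comp Primrec.fst) (primrecPred_exists_mem
    (primrec_occ.comp (Primrec.fst.comp Primrec.fst)) (primrecPred_exists_mem
      (primrec_occ.comp z) ?_))
  refine PrimrecPred.and (Primrec.eq.comp (z.comp Primrec.fst)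
    (primrec_wordTuple_triple u v w)) ?_
  refine (t.comp u).and ((t.comp v).and ((t.comp w).and (PrimrecPred.and ?_ ?_)))
  · exact Primrec.eq.comp (primrec_length_occ.comp w) (Primrec.nat_max.comp
      (primrec_length_occ.comp u) (primrec_length_occ.comp v))
  · refine primrecPred_forall_lt (primrec_length_occ.comp w) ?_
    exact primrecPred_seesInterAt hΦ
      (Primrec.snd.comp (Primrec.fst.comp (Primrec.fst.comp (Primrec.fst.comp Primrec.fst))))
      (u.comp Primrec.fst) (v.comp Primrec.fst) (w.comp Primrec.fst) Primrec.snd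

theorem primrec_prodSym : Primrec₂ (prodSym (A := A) Φ ok) := by
  have half : ∀ k, Primrec fun x : List A × ℕ => x.2 / k := fun k =>
    Primrec.nat_div.comp Primrec.snd (Primrec.const k)
  have rem : ∀ k r, PrimrecPred fun x : List A × ℕ => x.2 % k = r := fun k r =>
    Primrec.eq.comp (Primrec.nat_mod.comp Primrec.snd (Primrec.const k)) (Primrec.const r)
  exact Primrec.ite (rem 2 1)
    ((primrec_enumSym (primrecRel_enumCover hΦ hok)).comp Primrec.fst (half 2))
    (Primrec.ite (rem 4 0)
      ((primrec_enumSym (primrecRel_enumDom hΦ hok)).comp Primrec.fst (half 4))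
      ((primrec_enumSym (primrecRel_enumInter hΦ hok)).comp Primrec.fst (half 4)))

end

end Checks

end TTE

namespace TTE

/-! ## Binary and countable products -/

section Products

theorem computableWrt_of_prodName {A : Type} [Zero A] [One A] [DecidableEq A] [Finite A]
    [Primcodable A] {M : Type u} {M' : Type v}
    {γ : MultiRep A M} {γ' : MultiRep A M'} {f : M →. M'} {Φ : ℕ → ℕ → ℕ} {ok : ℕ → Prop}
    (hΦ : Primrec₂ Φ) (hok : PrimrecPred ok)
    (h : ∀ p x, x ∈ γ p → ∀ y ∈ f x, y ∈ γ' (prodName Φ ok p)) : ComputableWrt γ γ' f := by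
  refine computableWrt_of_primrec (H := fun l => some (prodSym Φ ok l (l.length - 1)))
    (Primrec.option_some.comp ((primrec_prodSym hΦ hok).comp Primrec.id
      (Primrec.nat_sub.comp Primrec.list_length (Primrec.const 1)))) fun p x hx y hy => ?_
  refine ⟨_, h p x hx y hy, fun n => ⟨n + 1, ?_⟩⟩
  have e : ((List.range (n + 1)).flatMap fun i =>
      (some (prodSym Φ ok (pre p (i + 1)) ((pre p (i + 1)).length - 1))).toList) =
      pre (prodName Φ ok p) (n + 1) := by
    simp only [length_pre, Nat.add_sub_cancel, Option.toList_some]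
    rw [pre, ← List.flatMap_singleton' (List.map _ _), List.flatMap_map]
    simp only [prodSym_pre p (Nat.le_succ _)]
  rw [e, getElem?_pre, if_pos (Nat.lt_succ_self n)]

variable {A : Type} [Zero A] [One A] [NeZero (1 : A)]

/-- The pairs of a binary product as a sequence; the second one is repeated. -/
def pairSeq (C : CompactPair.{u} A × CompactPair.{u} A) : ℕ → CompactPair.{u} A
  | 0 => C.1
  | _ + 1 => C.2

/-- The components of a point of a binary product, along `pairSeq`. -/
def pairProj (C : CompactPair.{u} A × CompactPair.{u} A)
    (y : (CompactPair.prod C).space.carrier) : ∀ i, (pairSeq C i).space.carrier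
  | 0 => y.1
  | _ + 1 => y.2

/-- The positions in `⟨p₁, p₂⟩` of the symbols of the components, along `pairSeq`. -/
def pairIndex (i j : ℕ) : ℕ := 2 * j + if i = 0 then 0 else 1

theorem isProduct_pair (C : CompactPair.{u} A × CompactPair.{u} A) :
    IsProduct (pairSeq C) (· = 2) (CompactPair.prod C) (pairProj C) where
  mem_dom_iff w := by
    constructor
    · rintro ⟨u₁, u₂, rfl, h₁, h₂⟩
      refine ⟨[u₁, u₂], rfl, rfl, fun i hi => ?_⟩
      match i, hi with
      | 0, _ => exact h₁
      | 1, _ => exact h₂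
    · rintro ⟨us, hlen, rfl, h⟩
      obtain ⟨u₁, u₂, rfl⟩ := List.length_eq_two.1 hlen
      exact ⟨u₁, u₂, rfl, h 0 (by simp), h 1 (by simp)⟩
  inBase_iff w y := by
    constructor
    · rintro ⟨S, hS, hy⟩
      obtain ⟨u₁, u₂, rfl, U, hU, V, hV, rfl⟩ := mem_prodNu.1 hS
      refine ⟨[u₁, u₂], rfl, rfl, fun i hi => ?_⟩
      match i, hi with
      | 0, _ => exact ⟨U, hU, hy.1⟩
      | 1, _ => exact ⟨V, hV, hy.2⟩
    · rintro ⟨us, hlen, rfl, h⟩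
      obtain ⟨u₁, u₂, rfl⟩ := List.length_eq_two.1 hlen
      obtain ⟨U, hU, hyU⟩ := h 0 (by simp)
      obtain ⟨V, hV, hyV⟩ := h 1 (by simp)
      exact ⟨U ×ˢ V, mem_prodNu.2 ⟨u₁, u₂, rfl, U, hU, V, hV, rfl⟩, hyU, hyV⟩
  proj_mem y hy i := by
    cases i with
    | zero => exact hy.1
    | succ i => exact hy.2
  exists_proj_eq x hx := by
    refine ⟨(x 0, x 1), ⟨hx 0, hx 1⟩, fun n hn i hi => ?_⟩
    subst hn
    match i, hi with
    | 0, _ => rfl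
    | 1, _ => rfl
  nonempty n hn h i := by
    subst hn
    cases i with
    | zero => exact h 0 (by norm_num)
    | succ i => exact h 1 (by norm_num)

theorem isProduct_pi {C : ℕ → CompactPair.{u} A} (hC : ∀ i, (C i).set.Nonempty) :
    IsProduct C (· ≠ 0) (CompactPair.pi C) (fun y => y) where
  mem_dom_iff w := by
    simp only [ne_eq, List.length_eq_zero_iff]
    rfl
  inBase_iff w y := by
    simp only [ne_eq, List.length_eq_zero_iff]
    constructor
    · rintro ⟨S, hS, hy⟩
      obtain ⟨us, hne, rfl, U, hU, rfl⟩ := mem_piNu.1 hS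
      exact ⟨us, hne, rfl, fun i hi => ⟨U i, hU i hi, hy i hi⟩⟩
    · rintro ⟨us, hne, rfl, h⟩
      have hd : (piNu (fun i => (C i).space) (wordTuple us)).Dom :=
        ⟨us, hne, rfl, fun i hi => (h i hi).mem_dom⟩
      exact ⟨_, Part.get_mem hd, us, hne, rfl, h⟩
  proj_mem y hy i := hy i trivial
  exists_proj_eq x hx := ⟨x, fun i _ => hx i, fun _ _ _ _ => rfl⟩
  nonempty _ _ _ := hC

theorem strictMono_pairIndex (i : ℕ) : StrictMono (pairIndex i) := by
  intro j k h
  simp only [pairIndex]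
  lia

theorem strictMono_cantorPair (i : ℕ) : StrictMono (cantorPair i) := by
  refine strictMono_nat_of_lt_succ fun j => ?_
  have : (i + j) * (i + j + 1) ≤ (i + (j + 1)) * (i + (j + 1) + 1) :=
    Nat.mul_le_mul (by lia) (by lia)
  have := Nat.div_le_div_right (c := 2) this
  simp only [cantorPair]
  lia

theorem primrec_pairIndex : Primrec₂ pairIndex :=
  Primrec.nat_add.comp (Primrec.nat_mul.comp (Primrec.const 2) Primrec.snd)
    (Primrec.ite (Primrec.eq.comp Primrec.fst (Primrec.const 0)) (Primrec.const 0)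
      (Primrec.const 1))

theorem primrec_cantorPair : Primrec₂ cantorPair := by
  have h : Primrec fun x : ℕ × ℕ => x.1 + x.2 := Primrec.nat_add
  exact Primrec.nat_add.comp (Primrec.nat_div.comp
    (Primrec.nat_mul.comp h (Primrec.succ.comp h)) (Primrec.const 2)) Primrec.snd

variable [DecidableEq A]

theorem prod_mem_prodName [Encodable A] {C : CompactPair.{u} A × CompactPair.{u} A} {p : ℕ → A}
    (h₁ : C.1 ∈ kappaTildeDelta (comp 2 0 p)) (h₂ : C.2 ∈ kappaTildeDelta (comp 2 1 p)) :
    CompactPair.prod C ∈ kappaTildeDelta (prodName pairIndex (· = 2) p) := by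
  refine (isProduct_pair C).mem_prodName strictMono_pairIndex fun i => ?_
  cases i with
  | zero => exact h₁
  | succ i => exact h₂

end Products

/-! ## Finite products -/

section FiniteProducts

variable {A : Type}

/-- The sequence `⟨q₁, q₂⟩`. -/
def merge (q₁ q₂ : ℕ → A) : ℕ → A := fun i => if i % 2 = 0 then q₁ (i / 2) else q₂ (i / 2)

theorem comp_merge_zero (q₁ q₂ : ℕ → A) : comp 2 0 (merge q₁ q₂) = q₁ := by
  funext j
  simp [comp, merge]

theorem comp_merge_one (q₁ q₂ : ℕ → A) : comp 2 1 (merge q₁ q₂) = q₂ := by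
  funext j
  simp only [comp, merge]
  rw [if_neg (by lia)]
  congr 1
  lia

theorem getD_pre {p : ℕ → A} {i n : ℕ} (h : i < n) (a : A) : (pre p n).getD i a = p i := by
  rw [List.getD_eq_getElem?_getD, getElem?_pre, if_pos h, Option.getD_some]

variable [Zero A]

/-- The prefix version of `merge`. -/
def mergeList (l₁ l₂ : List A) : List A :=
  (List.range (2 * l₁.length)).map fun i =>
    if i % 2 = 0 then l₁.getD (i / 2) 0 else l₂.getD (i / 2) 0

theorem mergeList_pre (q₁ q₂ : ℕ → A) (n : ℕ) :
    mergeList (pre q₁ n) (pre q₂ n) = pre (merge q₁ q₂) (2 * n) := by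
  rw [mergeList, length_pre]
  refine List.map_congr_left fun i hi => ?_
  rw [List.mem_range] at hi
  rw [merge, getD_pre (by lia), getD_pre (by lia)]

/-- The first `L` symbols of the component `i` of `⟨p₁, …, pₙ⟩`, computed from a prefix of
`1ⁿ 0 ⟨p₁, …, pₙ⟩`. -/
def compList (n L : ℕ) (l : List A) (i : ℕ) : List A :=
  (List.range L).map fun j => l.getD (n + 1 + (n * j + i)) 0

theorem compList_pre {p : ℕ → A} {n L N i : ℕ} (hi : i < n) (hN : n + 1 + n * L ≤ N) :
    compList n L (pre p N) i = pre (comp n i fun j => p (n + 1 + j)) L := by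
  refine List.map_congr_left fun j hj => ?_
  rw [List.mem_range] at hj
  have : n * (j + 1) ≤ n * L := Nat.mul_le_mul_left n hj
  rw [getD_pre (by lia)]
  rfl

variable [One A] [DecidableEq A]

theorem idxOf_pre [NeZero (1 : A)] {p : ℕ → A} {n N : ℕ} (h1 : ∀ i < n, p i = 1) (h0 : p n = 0) :
    (pre p N).idxOf 0 = min n N := by
  have h10 : (1 : A) ≠ 0 := NeZero.ne 1
  induction N with
  | zero => simp [pre]
  | succ N ih =>
    rw [pre_succ, List.idxOf_append]
    by_cases hN : N ≤ n
    · have hnot : (0 : A) ∉ pre p N := by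
        rw [← List.idxOf_lt_length_iff, ih, length_pre]
        lia
      rw [if_neg hnot, length_pre]
      rcases hN.lt_or_eq with hlt | rfl
      · rw [h1 N hlt, List.idxOf_cons_ne _ h10]
        simp
        lia
      · rw [h0, List.idxOf_cons_self]
        simp
    · have hmem : (0 : A) ∈ pre p N := by
        rw [← List.idxOf_lt_length_iff, ih, length_pre]
        lia
      rw [if_pos hmem, ih]
      lia

variable [Encodable A]

/-- The prefix version of the name of a binary product. -/
noncomputable def prodList (l₁ l₂ : List A) : List A :=
  (List.range l₁.length).map (prodSym pairIndex (· = 2) (mergeList l₁ l₂))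

theorem prodList_pre (q₁ q₂ : ℕ → A) (n : ℕ) :
    prodList (pre q₁ n) (pre q₂ n) = pre (prodName pairIndex (· = 2) (merge q₁ q₂)) n := by
  rw [prodList, mergeList_pre, length_pre, pre]
  refine List.map_congr_left fun i hi => prodSym_pre _ ?_
  rw [List.mem_range] at hi
  lia

/-- The name of a finite product of `m + 1` factors. -/
noncomputable def finName (c : ℕ → ℕ → A) : ℕ → ℕ → A
  | 0 => c 0
  | m + 1 => prodName pairIndex (· = 2) (merge (finName c m) (c (m + 1)))

theorem foldl_prodList (c : ℕ → ℕ → A) (L m : ℕ) :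
    ((List.range m).map fun i => pre (c (i + 1)) L).foldl prodList (pre (c 0) L) =
      pre (finName c m) L := by
  induction m with
  | zero => rfl
  | succ m ih =>
    rw [List.range_succ, List.map_append, List.foldl_append, ih]
    exact prodList_pre _ _ _

theorem finProdAux_mem_finName [NeZero (1 : A)] {c : ℕ → ℕ → A} (m : ℕ)
    (C : Fin (m + 1) → CompactPair.{u} A) (h : ∀ i : Fin (m + 1), C i ∈ kappaTildeDelta (c i)) :
    CompactPair.finProdAux m C ∈ kappaTildeDelta (finName c m) := by
  induction m with
  | zero => exact h 0
  | succ m ih =>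
    refine prod_mem_prodName ?_ ?_
    · rw [comp_merge_zero]
      exact ih _ fun i => h i.castSucc
    · rw [comp_merge_one]
      exact h (Fin.last (m + 1))

/-- The symbol of the name of a finite product that is written when the prefix `l` of the input
has been read, if any. -/
noncomputable def finSym (l : List A) : Option A :=
  if (l.length - (l.idxOf 0 + 1)) % l.idxOf 0 = 0 then
    (((List.range (l.idxOf 0 - 1)).map fun i =>
      compList (l.idxOf 0) ((l.length - (l.idxOf 0 + 1)) / l.idxOf 0) l (i + 1)).foldl prodList
        (compList (l.idxOf 0) ((l.length - (l.idxOf 0 + 1)) / l.idxOf 0) l 0))[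
          (l.length - (l.idxOf 0 + 1)) / l.idxOf 0 - 1]?
  else none

theorem finSym_pre [NeZero (1 : A)] {p : ℕ → A} {m : ℕ} (h1 : ∀ i < m + 1, p i = 1)
    (h0 : p (m + 1) = 0) (r : ℕ) :
    finSym (pre p (m + 1 + 1 + r)) = if r % (m + 1) = 0 ∧ r ≠ 0 then
      some (finName (fun i => comp (m + 1) i fun j => p (m + 1 + 1 + j)) m (r / (m + 1) - 1))
    else none := by
  have hidx : (pre p (m + 1 + 1 + r)).idxOf 0 = m + 1 := by
    rw [idxOf_pre h1 h0]
    lia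
  have hlen : (pre p (m + 1 + 1 + r)).length - (m + 1 + 1) = r := by
    rw [length_pre]
    lia
  have hL := Nat.mul_div_le r (m + 1)
  rw [finSym, hidx, hlen, compList_pre (by lia) (by lia), Nat.add_sub_cancel]
  have e : ((List.range m).map fun i =>
      compList (m + 1) (r / (m + 1)) (pre p (m + 1 + 1 + r)) (i + 1)) =
      (List.range m).map fun i => pre (comp (m + 1) (i + 1) fun j => p (m + 1 + 1 + j))
        (r / (m + 1)) := by
    refine List.map_congr_left fun i hi => ?_
    rw [List.mem_range] at hi
    exact compList_pre (by lia) (by lia)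
  rw [e, foldl_prodList (fun i => comp (m + 1) i fun j => p (m + 1 + 1 + j)), getElem?_pre]
  by_cases hr : r % (m + 1) = 0
  · by_cases hr0 : r = 0
    · simp [hr0]
    · have : 0 < r / (m + 1) :=
        Nat.div_pos (Nat.le_of_dvd (by lia) (Nat.dvd_of_mod_eq_zero hr)) (by lia)
      rw [if_pos hr, if_pos (by lia), if_pos ⟨hr, hr0⟩]
  · rw [if_neg hr, if_neg fun h => hr h.1]

theorem finSym_pre_of_le [NeZero (1 : A)] {p : ℕ → A} {n N : ℕ} (h1 : ∀ i < n, p i = 1)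
    (h0 : p n = 0) (hN : N ≤ n + 1) : finSym (pre p N) = none := by
  have hidx := idxOf_pre (N := N) h1 h0
  have hlen : N - (min n N + 1) = 0 := by lia
  rw [finSym, hidx, length_pre, hlen, Nat.zero_div]
  have key : ∀ L : List (List A), L.foldl prodList [] = [] := by
    intro L
    induction L with
    | nil => rfl
    | cons a L ih => exact ih
  simp [compList, key]

theorem flatMap_finSym [NeZero (1 : A)] {p : ℕ → A} {m : ℕ} (h1 : ∀ i < m + 1, p i = 1)
    (h0 : p (m + 1) = 0) (r : ℕ) :
    ((List.range (m + 1 + 1 + r)).flatMap fun i => (finSym (pre p (i + 1))).toList) =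
      pre (finName (fun i => comp (m + 1) i fun j => p (m + 1 + 1 + j)) m) (r / (m + 1)) := by
  induction r with
  | zero =>
    rw [Nat.zero_div, pre, List.range_zero, List.map_nil, List.flatMap_eq_nil_iff]
    intro i hi
    rw [List.mem_range] at hi
    rw [finSym_pre_of_le h1 h0 (by lia), Option.toList_none]
  | succ r ih =>
    rw [← Nat.add_assoc, List.range_succ, List.flatMap_append, ih, Nat.succ_div,
      List.flatMap_singleton, Nat.add_assoc (m + 1 + 1), finSym_pre h1 h0]
    by_cases hr : (r + 1) % (m + 1) = 0
    · have hd := Nat.dvd_of_mod_eq_zero hr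
      rw [if_pos ⟨hr, by lia⟩, if_pos hd, pre_succ, Option.toList_some, Nat.succ_div, if_pos hd,
        Nat.add_sub_cancel]
    · rw [if_neg fun h => hr h.1, if_neg fun h => hr (Nat.mod_eq_zero_of_dvd h)]
      simp

end FiniteProducts

section FiniteProductsPrimrec

variable {A : Type} [Primcodable A] [Zero A]

theorem primrec_mergeList : Primrec₂ (mergeList : List A → List A → List A) := by
  refine Primrec.list_map (Primrec.list_range.comp (Primrec.nat_mul.comp (Primrec.const 2)
    (Primrec.list_length.comp Primrec.fst))) ?_
  have half : Primrec fun x : (List A × List A) × ℕ => x.2 / 2 :=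
    Primrec.nat_div.comp Primrec.snd (Primrec.const 2)
  exact Primrec.ite (Primrec.eq.comp (Primrec.nat_mod.comp Primrec.snd (Primrec.const 2))
      (Primrec.const 0))
    ((Primrec.list_getD 0).comp (Primrec.fst.comp Primrec.fst) half)
    ((Primrec.list_getD 0).comp (Primrec.snd.comp Primrec.fst) half)

theorem primrec_compList {α : Type*} [Primcodable α] {n L i : α → ℕ} {l : α → List A}
    (hn : Primrec n) (hL : Primrec L) (hl : Primrec l) (hi : Primrec i) :
    Primrec fun a => compList (n a) (L a) (l a) (i a) := by
  refine Primrec.list_map (Primrec.list_range.comp hL) ?_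
  refine (Primrec.list_getD 0).comp (hl.comp Primrec.fst) ?_
  have hn' := hn.comp (Primrec.fst (α := α) (β := ℕ))
  exact Primrec.nat_add.comp (Primrec.succ.comp hn') (Primrec.nat_add.comp
    (Primrec.nat_mul.comp hn' Primrec.snd) (hi.comp Primrec.fst))

variable [One A] [DecidableEq A]

theorem primrec_prodList : Primrec₂ (prodList : List A → List A → List A) :=
  Primrec.list_map (Primrec.list_range.comp (Primrec.list_length.comp Primrec.fst))
    ((primrec_prodSym primrec_pairIndex (Primrec.eq.comp Primrec.id (Primrec.const 2))).comp
      (primrec_mergeList.comp (Primrec.fst.comp Primrec.fst) (Primrec.snd.comp Primrec.fst))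
      Primrec.snd)

theorem primrec_finSym : Primrec (finSym : List A → Option A) := by
  have n : Primrec fun l : List A => l.idxOf 0 :=
    Primrec.list_idxOf.comp (Primrec.const 0) Primrec.id
  have r : Primrec fun l : List A => l.length - (l.idxOf 0 + 1) :=
    Primrec.nat_sub.comp Primrec.list_length (Primrec.succ.comp n)
  have L := Primrec.nat_div.comp r n
  refine Primrec.ite (Primrec.eq.comp (Primrec.nat_mod.comp r n) (Primrec.const 0)) ?_
    (Primrec.const none)
  refine Primrec.list_getElem?.comp (Primrec.list_foldl (Primrec.list_map (Primrec.list_range.comp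
    (Primrec.nat_sub.comp n (Primrec.const 1))) ?_) (primrec_compList n L Primrec.id
      (Primrec.const 0)) (h := fun _ x => prodList x.1 x.2) ?_)
    (Primrec.nat_sub.comp L (Primrec.const 1))
  · exact primrec_compList (n.comp Primrec.fst) (L.comp Primrec.fst) Primrec.fst
      (Primrec.succ.comp Primrec.snd)
  · exact primrec_prodList.comp (Primrec.fst.comp Primrec.snd) (Primrec.snd.comp Primrec.snd)

end FiniteProductsPrimrec

end TTE

theorem corollary1 {A : Type} [Finite A] [Zero A] [One A] [NeZero (1 : A)] :
    TTE.ComputableWrt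
      (TTE.MultiRep.pair TTE.kappaTildeDelta TTE.kappaTildeDelta)
      TTE.kappaTildeDelta
      (TTE.CompactPair.prod.{u} (A := A) :
        TTE.CompactPair.{u} A × TTE.CompactPair.{u} A →. TTE.CompactPair.{u} A) ∧
    TTE.ComputableWrt
      (TTE.MultiRep.plus TTE.kappaTildeDelta)
      TTE.kappaTildeDelta
      (TTE.CompactPair.finProd.{u} (A := A) :
        (Σ m : ℕ, Fin (m + 1) → TTE.CompactPair.{u} A) →. TTE.CompactPair.{u} A) ∧
    TTE.ComputableWrt
      (TTE.MultiRep.seq TTE.kappaTildeDelta)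
      TTE.kappaTildeDelta
      (TTE.CompactPair.piNonempty.{u} (A := A)) := by
  classical
  obtain ⟨n, ⟨e⟩⟩ := Finite.exists_equiv_fin A
  let _ : Primcodable A := Primcodable.ofEquiv (Fin n) e
  refine ⟨?_, ?_, ?_⟩
  · refine TTE.computableWrt_of_prodName TTE.primrec_pairIndex
      (Primrec.eq.comp Primrec.id (Primrec.const 2)) fun p x hx y hy => ?_
    rw [PFun.coe_val, Part.mem_some_iff] at hy
    subst hy
    exact TTE.prod_mem_prodName hx.1 hx.2
  · refine TTE.computableWrt_of_primrec TTE.primrec_finSym fun p x hx y hy => ?_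
    rw [PFun.coe_val, Part.mem_some_iff] at hy
    subst hy
    obtain ⟨m, C⟩ := x
    obtain ⟨h1, h0, hC⟩ := hx
    refine ⟨_, TTE.finProdAux_mem_finName
      (c := fun i => TTE.comp (m + 1) i fun j => p (m + 1 + 1 + j)) m C hC, fun k => ⟨m + 1 + 1 + (m + 1) * (k + 1), ?_⟩⟩
    rw [TTE.flatMap_finSym h1 h0, TTE.getElem?_pre, Nat.mul_div_cancel_left _ (by lia),
      if_pos (by lia)]
  · refine TTE.computableWrt_of_prodName TTE.primrec_cantorPair
      (Primrec.eq.comp Primrec.id (Primrec.const 0)).not fun p x hx y hy => ?_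
    obtain ⟨hne, rfl⟩ := hy
    exact (TTE.isProduct_pi hne).mem_prodName TTE.strictMono_cantorPair hx
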